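/- Let $\mathcal S$ and $\mathcal A$ be finite nonempty sets, let $p(\cdot\mid s,a)$ be the transition probabilities and $r:\mathcal S\times\mathcal A\to[0,1]$ the rewards of a Markov decision process, and assume that it is unichain: for every stationary policy, the induced Markov chain on $\mathcal S$ has a single recurrent class. For a randomized stationary policy $\pi$ let $V_\pi(s)=\liminf_{N\to\infty}\mathbb E\big(\frac1N\sum_{k=0}^{N-1}r(s_k,a_k)\,\big|\,s_0=s\big)$ be its average reward, and let $v^*=\max_\pi V_\pi(s)$ be the optimal average reward, which does not depend on $s$. Define $\mathcal H:\mathbb R^{\mathcal S\times\mathcal A}\to\mathbb R^{\mathcal S\times\mathcal A}$ by $$\mathcal HQ(s,a)=\sum_{s'\in\mathcal S}p(s'\mid s,a)\Big(r(s,a)+\max_{a'\in\mathcal A}Q(s',a')\Big)-v^*,$$ and let $\operatorname{Fix}\mathcal H$ be the set of its fixed points. Let $f:\mathbb R^{\mathcal S\times\mathcal A}\to\mathbb R$ satisfy $f(Q+c\,\mathbf e)=f(Q)+c$ for all $Q$ and all $c\in\mathbb R$, where $\mathbf e$ is the all-ones table. From an initial table $Q^0$, Halpern synchronous $Q$-learning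 computes, for $n=1,\dots,N$, with $\beta_n=\frac n{n+1}$ and $k_n=n^6$, $$Q^n(s,a)=(1-\beta_n)Q^0(s,a)+\beta_n\Big(r(s,a)+\frac1{k_n}\sum_{i=1}^{k_n}\max_{a'\in\mathcal A}Q^{n-1}\big(s_{n,i}(s,a),a'\big)-f(Q^{n-1})\Big),$$ where $s_{n,i}(s,a)\sim p(\cdot\mid s,a)$ and the families $(s_{n,i}(s,a))_{(s,a)}$ are independent over all $(n,i)$; each sample $s_{n,i}(s,a)$ is one call to the sampling device. Then for every $\varepsilon>0$ there is an $N$ such that the iterate $Q^N$ satisfies $\mathbb E\|\mathcal HQ^N-Q^N\|_\infty\le\varepsilon$ and is computed with at most $\tilde O\big(|\mathcal S\times\mathcal A|\,\varepsilon^{-7}\big)$ calls. Precisely: there is an absolute exponent $p$, and for each $B$ a constant $C>0$ that depends only on $B$, such that whenever $\|Q^0\|_\infty\le B$ and $\operatorname{dist}_\infty(Q^0,\operatorname{Fix}\mathcal H)\le B$, the number of calls is at most $$C\,|\mathcal S\times\mathcal A|\,\varepsilon^{-7}\,\Big(\log\big(2+|\mathcal S\times\mathcal A|/\varepsilon\big)\Big)^{p}.$$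 -/

import Mathlib

open MeasureTheory ProbabilityTheory

noncomputable section

namespace AvgMDP

/-- A finite Markov decision process with rewards in `[0,1]`: `trans s a s'` is the probability
`p(s' | s, a)` of moving to `s'` when the action `a` is chosen in the state `s`. -/
structure MDP (S A : Type*) [Fintype S] where
  trans : S → A → S → ℝ
  trans_nonneg : ∀ s a s', 0 ≤ trans s a s'
  trans_sum : ∀ s a, ∑ s', trans s a s' = 1
  reward : S → A → ℝ
  reward_nonneg : ∀ s a, 0 ≤ reward s a
  reward_le_one : ∀ s a, reward s a ≤ 1

/-- A randomized stationary policy: `prob s a` is the probability of choosing `a` in state `s`. -/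
structure Policy (S A : Type*) [Fintype A] where
  prob : S → A → ℝ
  prob_nonneg : ∀ s a, 0 ≤ prob s a
  prob_sum : ∀ s, ∑ a, prob s a = 1

/-- A recurrent class of a finite Markov chain with transition matrix `P`: a nonempty set `C` of
states such that the states accessible from any state of `C` are exactly the states of `C`
(a closed communicating class). -/
def IsRecurrentClass {S : Type*} [Fintype S] [DecidableEq S] (P : Matrix S S ℝ) (C : Set S) :
    Prop :=
  C.Nonempty ∧ ∀ s ∈ C, ∀ t, (∃ k : ℕ, 0 < (P ^ k) s t) ↔ t ∈ C

/-- The weight `β_n = n / (n + 1)`. -/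
def halpernWeight (n : ℕ) : ℝ := (n : ℝ) / ((n : ℝ) + 1)

/-- The size `k_n = n ^ 6` of the minibatch of iteration `n`. -/
def batchSize (n : ℕ) : ℕ := n ^ 6

/-- `max_{a'} Q(s, a')`. -/
def maxAction {S A : Type*} [Fintype A] [Nonempty A] (Q : S × A → ℝ) (s : S) : ℝ :=
  Finset.univ.sup' Finset.univ_nonempty fun a' => Q (s, a')

/-- The current `Q`-table together with the number of calls made so far to the sampling device. -/
structure RunState (S A : Type*) where
  Q : S × A → ℝ
  calls : ℕ

namespace MDP

variable {S A : Type*} [Fintype S] [Fintype A] [DecidableEq S]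

/-- Transition matrix of the chain induced by a deterministic stationary policy `d`. -/
def detMatrix (M : MDP S A) (d : S → A) : Matrix S S ℝ :=
  Matrix.of fun s s' => M.trans s (d s) s'

/-- Unichain assumption: under every deterministic stationary policy the induced Markov chain has
a single recurrent class. -/
def Unichain (M : MDP S A) : Prop :=
  ∀ d : S → A, ∃! C : Set S, IsRecurrentClass (M.detMatrix d) C

/-- Transition matrix of the chain of states induced by a randomized stationary policy. -/
def policyMatrix (M : MDP S A) (π : Policy S A) : Matrix S S ℝ :=
  Matrix.of fun s s' => ∑ a, π.prob s a * M.trans s a s'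

/-- `E (r(s_k, a_k) | s_0 = s)` along the trajectory induced by `π`: given `s_0 = s`, the state
`s_k` has the law `(P_π ^ k) s ·`, and `a_k` has the law `π.prob s_k`. -/
def expectedReward (M : MDP S A) (π : Policy S A) (s : S) (k : ℕ) : ℝ :=
  ∑ t, (M.policyMatrix π ^ k) s t * ∑ a, π.prob t a * M.reward t a

/-- The average reward `V_π(s)`. -/
def avgReward (M : MDP S A) (π : Policy S A) (s : S) : ℝ :=
  Filter.liminf
    (fun N : ℕ => (1 / (N : ℝ)) * ∑ k ∈ Finset.range N, M.expectedReward π s k) Filter.atTop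

/-- The optimal average reward `V_*(s)`. -/
def optValue (M : MDP S A) (s : S) : ℝ := ⨆ π : Policy S A, M.avgReward π s

/-- The operator
`Q ↦ ((s, a) ↦ ∑ s', p(s' | s, a) (r(s, a) + max_{a'} Q(s', a')) - v)`. -/
def bellman [Nonempty A] (M : MDP S A) (v : ℝ) (Q : S × A → ℝ) : S × A → ℝ := fun x =>
  ∑ s', M.trans x.1 x.2 s' * (M.reward x.1 x.2 + maxAction Q s') - v

/-- `X n i (s, a)` is the `i`-th sample of the next state drawn at iteration `n` for the pair
`(s, a)`. Each has the law `p(· | s, a)`, and the vectors `(X n i (s, a))_{(s, a)}` are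
independent over all `(n, i)`. No condition is put on the joint law over the pairs `(s, a)`. -/
structure IsSampling [MeasurableSpace S] (M : MDP S A) {Ω : Type*} [MeasurableSpace Ω]
    (μ : Measure Ω) (X : ℕ → ℕ → S × A → Ω → S) : Prop where
  measurable : ∀ n i x, Measurable (X n i x)
  law : ∀ n i x s', μ.real {ω | X n i x ω = s'} = M.trans x.1 x.2 s'
  indep : iIndepFun (fun (j : ℕ × ℕ) (ω : Ω) (x : S × A) => X j.1 j.2 x ω) μ

/-- Halpern synchronous `Q`-learning with weights `β`, offset function `f`, initial point `Q₀` and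
realized samples `x n i (s, a)`: the state after a given number of iterations. At iteration
`n + 1`, `batchSize (n + 1)` samples are drawn for each pair, and each draw is one call. -/
def run [Nonempty A] (M : MDP S A) (β : ℕ → ℝ) (f : (S × A → ℝ) → ℝ) (Q₀ : S × A → ℝ)
    (x : ℕ → ℕ → S × A → S) : ℕ → RunState S A
  | 0 => ⟨Q₀, 0⟩
  | n + 1 =>
    let st := run M β f Q₀ x n
    { Q := fun y =>
        (1 - β (n + 1)) * Q₀ y +
          β (n + 1) *
            (M.reward y.1 y.2 +
              (1 / (batchSize (n + 1) : ℝ)) *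
                ∑ i ∈ Finset.range (batchSize (n + 1)), maxAction st.Q (x (n + 1) i y) -
              f st.Q)
      calls := st.calls + ∑ _y : S × A, batchSize (n + 1) }

/-- The algorithm run with the weights `β_n = n / (n + 1)` on the random samples `X`: the random
state after `N` iterations. -/
def randomRun [Nonempty A] (M : MDP S A) (f : (S × A → ℝ) → ℝ) (Q₀ : S × A → ℝ) {Ω : Type*}
    (X : ℕ → ℕ → S × A → Ω → S) (N : ℕ) (ω : Ω) : RunState S A :=
  M.run halpernWeight f Q₀ (fun n i x => X n i x ω) N

end MDP

end AvgMDP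

end

/-! Everything is reduced to a Halpern iteration of a nonexpansive map with small random errors. The
tables produced with `f` and with any constant offset differ by a constant function, and `bellman v
Q - Q` is unchanged when a constant is added to `Q`. Hence `f` may be replaced by the optimal
average reward `v`. The iteration then becomes `x (n+1) = (1 - β) x 0 + β (T (x n) + u n)`, where `T
= bellman v` is nonexpansive in the sup norm and `u n` is the minibatch error.

Three facts are needed. First, `T` has a fixed point `z`. This follows from a vanishing-discount
argument (`exists_bellman_eq`), where the unichain assumption gives compactness, and from
identifying the constant in the optimality equation with the optimal value
(`optValue_eq_of_bellman_eq`).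

Second, the error is `O(1/n²)` in mean (`integral_norm_noise_le`). Since `v ∈ [0,1]`, the tables
grow at most linearly, while a batch of size `n ^ 6` gains a factor `n ^ 3`. Sub-Gaussian
concentration makes the dependence on the number of pairs only `√log`.

Third, the Halpern recursion with such errors keeps the mean distance to `z` bounded, makes the mean
steps `O(log n / n)`, and therefore also the mean residual (`integral_residual_le`).

About `l² / ε` iterations suffice, with `l = log (2 + |S × A| / ε)`. They cost at most `|S × A| n ^
7` calls, whence the exponents 7 and 14. -/

noncomputable section

namespace AvgMDP

/-! ### Harmonic functions of a chain with one recurrent class -/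

section Harmonic

variable {S : Type*} [Fintype S] [DecidableEq S] {P : Matrix S S ℝ}

/-- If an upper bound of a harmonic function of a stochastic matrix is attained at `s`, it is
attained at every state accessible from `s`. -/
lemma eq_of_accessible_of_harmonic (hP : P ∈ Matrix.rowStochastic ℝ S) {g : S → ℝ}
    (hg : P.mulVec g = g) {m : ℝ} (hm : ∀ s, g s ≤ m) {s t : S} (hs : g s = m) {k : ℕ}
    (hk : 0 < (P ^ k) s t) : g t = m := by
  have hPk : P ^ k ∈ Matrix.rowStochastic ℝ S := pow_mem hP k
  have hgk : (P ^ k).mulVec g = g := by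
    clear hk hPk
    induction k with
    | zero => simp
    | succ k ih => rw [pow_succ, ← Matrix.mulVec_mulVec, hg, ih]
  have hzero : ∑ u, (P ^ k) s u * (m - g u) = 0 := by
    have h1 : ∑ u, (P ^ k) s u * g u = m := by
      rw [← hs]; exact congrFun hgk s
    simp only [mul_sub, Finset.sum_sub_distrib, h1, ← Finset.sum_mul,
      Matrix.sum_row_of_mem_rowStochastic hPk, one_mul, sub_self]
  have h2 := (Finset.sum_eq_zero_iff_of_nonneg (fun u _ =>
    mul_nonneg (Matrix.nonneg_of_mem_rowStochastic hPk) (sub_nonneg.2 (hm u)))).1 hzero t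
    (Finset.mem_univ t)
  rcases mul_eq_zero.1 h2 with h | h
  · exact absurd h hk.ne'
  · linarith

/-- A nonempty set of states that is closed under accessibility contains a recurrent class. -/
lemma exists_isRecurrentClass_subset (hP : P ∈ Matrix.rowStochastic ℝ S) {D : Set S}
    (hD : D.Nonempty) (hcl : ∀ s ∈ D, ∀ t, (∃ k : ℕ, 0 < (P ^ k) s t) → t ∈ D) :
    ∃ C ⊆ D, IsRecurrentClass P C := by
  let R : S → Set S := fun s => {t | ∃ k : ℕ, 0 < (P ^ k) s t}
  have hrefl : ∀ s, s ∈ R s := fun s => ⟨0, by simp⟩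
  have htrans : ∀ s, ∀ t ∈ R s, R t ⊆ R s := by
    rintro s t ⟨k, hk⟩ u ⟨l, hl⟩
    refine ⟨k + l, ?_⟩
    rw [pow_add, Matrix.mul_apply]
    refine lt_of_lt_of_le (mul_pos hk hl)
      (Finset.single_le_sum (f := fun j => (P ^ k) s j * (P ^ l) j u) (fun j _ => ?_)
        (Finset.mem_univ t))
    exact mul_nonneg (Matrix.nonneg_of_mem_rowStochastic (pow_mem hP k))
      (Matrix.nonneg_of_mem_rowStochastic (pow_mem hP l))
  -- A smallest reachable set is a communicating class: each of its points reaches a subset of it,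
  -- which by minimality is all of it.
  obtain ⟨s, hsD, hmin⟩ := Set.exists_min_image D (fun s => (R s).ncard) (Set.toFinite D) hD
  refine ⟨R s, hcl s hsD, ⟨s, hrefl s⟩, fun t ht u => ?_⟩
  have hsub := htrans s t ht
  have heq : R t = R s :=
    Set.eq_of_subset_of_ncard_le hsub (hmin t (hcl s hsD t ht)) (Set.toFinite _)
  rw [← heq]; rfl

/-- Harmonic functions of a finite chain with a single recurrent class are constant. -/
lemma harmonic_const [Nonempty S] (hP : P ∈ Matrix.rowStochastic ℝ S)
    (huniq : ∃! C : Set S, IsRecurrentClass P C) {g : S → ℝ} (hg : P.mulVec g = g) (s t : S) :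
    g s = g t := by
  obtain ⟨a, ha⟩ := Finite.exists_max g
  obtain ⟨b, hb⟩ := Finite.exists_min g
  -- The sets where `g` is maximal and where it is minimal are both closed under accessibility. Each
  -- contains a recurrent class, and uniqueness makes the two classes meet.
  obtain ⟨C, hC, hCrec⟩ := exists_isRecurrentClass_subset hP (D := {u | g u = g a}) ⟨a, rfl⟩
    fun u hu v ⟨k, hk⟩ => eq_of_accessible_of_harmonic hP hg ha hu hk
  have hg' : P.mulVec (-g) = -g := by rw [Matrix.mulVec_neg, hg]
  obtain ⟨C', hC', hCrec'⟩ := exists_isRecurrentClass_subset hP (D := {u | g u = g b}) ⟨b, rfl⟩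
    fun u hu v ⟨k, hk⟩ => neg_injective (eq_of_accessible_of_harmonic hP hg' (m := -g b)
      (fun w => neg_le_neg (hb w)) (congrArg Neg.neg hu) hk)
  obtain rfl := huniq.unique hCrec hCrec'
  obtain ⟨c, hc⟩ := hCrec.1
  have hab : g a = g b := (hC hc).symm.trans (hC' hc)
  have h1 := ha s
  have h2 := hb s
  have h3 := ha t
  have h4 := hb t
  linarith

end Harmonic

/-! ### The maximum over actions -/

section MaxAction

variable {S A : Type*} [Fintype A] [Nonempty A]

lemma le_maxAction (Q : S × A → ℝ) (s : S) (a : A) : Q (s, a) ≤ maxAction Q s :=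
  Finset.le_sup' (fun a' => Q (s, a')) (Finset.mem_univ a)

lemma maxAction_le {Q : S × A → ℝ} {s : S} {c : ℝ} (h : ∀ a, Q (s, a) ≤ c) :
    maxAction Q s ≤ c :=
  Finset.sup'_le _ _ fun a _ => h a

lemma exists_eq_maxAction (Q : S × A → ℝ) (s : S) : ∃ a, Q (s, a) = maxAction Q s := by
  obtain ⟨a, -, ha⟩ := Finset.exists_mem_eq_sup' (Finset.univ_nonempty (α := A))
    (fun a' => Q (s, a'))
  exact ⟨a, ha.symm⟩

lemma maxAction_add_const (Q : S × A → ℝ) (c : ℝ) (s : S) :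
    maxAction (Q + fun _ => c) s = maxAction Q s + c := by
  apply le_antisymm
  · exact maxAction_le fun a => by simpa using le_maxAction Q s a
  · obtain ⟨a, ha⟩ := exists_eq_maxAction Q s
    rw [← ha]
    exact le_maxAction (Q + fun _ => c) s a

lemma maxAction_smul (Q : S × A → ℝ) {c : ℝ} (hc : 0 ≤ c) (s : S) :
    maxAction (c • Q) s = c * maxAction Q s := by
  apply le_antisymm
  · exact maxAction_le fun a => mul_le_mul_of_nonneg_left (le_maxAction Q s a) hc
  · obtain ⟨a, ha⟩ := exists_eq_maxAction Q s
    rw [← ha]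
    exact le_maxAction (c • Q) s a

variable [Fintype S]

lemma maxAction_sub_le (Q Q' : S × A → ℝ) (s : S) :
    maxAction Q s - maxAction Q' s ≤ ‖Q - Q'‖ := by
  obtain ⟨a, ha⟩ := exists_eq_maxAction Q s
  have h1 := le_maxAction Q' s a
  have h2 := (le_abs_self _).trans (norm_le_pi_norm (Q - Q') (s, a))
  simp only [Pi.sub_apply] at h2
  linarith

lemma abs_maxAction_sub_le (Q Q' : S × A → ℝ) (s : S) :
    |maxAction Q s - maxAction Q' s| ≤ ‖Q - Q'‖ :=
  abs_sub_le_iff.2 ⟨maxAction_sub_le Q Q' s, by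
    rw [norm_sub_rev]; exact maxAction_sub_le Q' Q s⟩

lemma abs_maxAction_le (Q : S × A → ℝ) (s : S) : |maxAction Q s| ≤ ‖Q‖ := by
  have h := abs_maxAction_sub_le Q 0 s
  have h0 : maxAction (0 : S × A → ℝ) s = 0 :=
    le_antisymm (maxAction_le fun _ => le_rfl) ((exists_eq_maxAction 0 s).elim fun _ ha => ha.le)
  simpa [h0] using h

end MaxAction

/-! ### Nonexpansiveness and invariances of the optimality operator -/

namespace MDP

variable {S A : Type*} [Fintype S] (M : MDP S A)

lemma abs_sum_trans_mul_le (s : S) (a : A) {g : S → ℝ} {c : ℝ} (hg : ∀ s', |g s'| ≤ c) :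
    |∑ s', M.trans s a s' * g s'| ≤ c := by
  calc |∑ s', M.trans s a s' * g s'| ≤ ∑ s', |M.trans s a s' * g s'| :=
        Finset.abs_sum_le_sum_abs _ _
    _ ≤ ∑ s', M.trans s a s' * c := Finset.sum_le_sum fun s' _ => by
        rw [abs_mul, abs_of_nonneg (M.trans_nonneg s a s')]
        exact mul_le_mul_of_nonneg_left (hg s') (M.trans_nonneg s a s')
    _ = c := by rw [← Finset.sum_mul, M.trans_sum, one_mul]

lemma detMatrix_mem_rowStochastic [DecidableEq S] (d : S → A) :
    M.detMatrix d ∈ Matrix.rowStochastic ℝ S :=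
  Matrix.mem_rowStochastic_iff_sum.2
    ⟨fun s s' => M.trans_nonneg s (d s) s', fun s => M.trans_sum s (d s)⟩

variable [Fintype A] [Nonempty A]

/-- The reward-free optimality operator `Q ↦ ((s, a) ↦ ∑ s', p(s' | s, a) max_{a'} Q(s', a'))`. -/
def transMax (Q : S × A → ℝ) : S × A → ℝ := fun x =>
  ∑ s', M.trans x.1 x.2 s' * maxAction Q s'

lemma bellman_apply (v : ℝ) (Q : S × A → ℝ) (x : S × A) :
    M.bellman v Q x = M.reward x.1 x.2 + M.transMax Q x - v := by
  simp only [bellman, transMax, mul_add, Finset.sum_add_distrib, ← Finset.sum_mul,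
    M.trans_sum, one_mul]

lemma norm_transMax_sub_le (Q Q' : S × A → ℝ) :
    ‖M.transMax Q - M.transMax Q'‖ ≤ ‖Q - Q'‖ := by
  refine (pi_norm_le_iff_of_nonneg (norm_nonneg _)).2 fun x => ?_
  have : (M.transMax Q - M.transMax Q') x =
      ∑ s', M.trans x.1 x.2 s' * (maxAction Q s' - maxAction Q' s') := by
    simp only [Pi.sub_apply, transMax, mul_sub, Finset.sum_sub_distrib]
  rw [this, Real.norm_eq_abs]
  exact M.abs_sum_trans_mul_le _ _ fun s' => abs_maxAction_sub_le Q Q' s'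

lemma norm_bellman_sub_le (v : ℝ) (Q Q' : S × A → ℝ) :
    ‖M.bellman v Q - M.bellman v Q'‖ ≤ ‖Q - Q'‖ := by
  have : M.bellman v Q - M.bellman v Q' = M.transMax Q - M.transMax Q' := by
    ext x; simp only [Pi.sub_apply, bellman_apply]; ring
  rw [this]; exact M.norm_transMax_sub_le Q Q'

lemma transMax_add_const (Q : S × A → ℝ) (c : ℝ) :
    M.transMax (Q + fun _ => c) = M.transMax Q + fun _ => c := by
  ext x
  simp only [transMax, maxAction_add_const, mul_add, Finset.sum_add_distrib, ← Finset.sum_mul,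
    M.trans_sum, one_mul, Pi.add_apply]

lemma bellman_add_const (v : ℝ) (Q : S × A → ℝ) (c : ℝ) :
    M.bellman v (Q + fun _ => c) = M.bellman v Q + fun _ => c := by
  ext x
  simp only [bellman_apply, transMax_add_const, Pi.add_apply]; ring

lemma transMax_smul (Q : S × A → ℝ) {c : ℝ} (hc : 0 ≤ c) :
    M.transMax (c • Q) = c • M.transMax Q := by
  ext x
  simp only [transMax, maxAction_smul Q hc, Pi.smul_apply, smul_eq_mul, Finset.mul_sum]
  exact Finset.sum_congr rfl fun _ _ => by ring

/-- In a unichain MDP the fixed points of the reward-free optimality operator are constant. -/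
lemma const_of_transMax_eq [DecidableEq S] [Nonempty S] (hM : M.Unichain) {Q : S × A → ℝ}
    (hQ : M.transMax Q = Q) (x y : S × A) : Q x = Q y := by
  -- Under the greedy policy `d` the maximum `maxAction Q` is harmonic.
  choose d hd using exists_eq_maxAction Q
  have hharm : (M.detMatrix d).mulVec (maxAction Q) = maxAction Q := by
    ext s
    rw [← hd s]
    exact congrFun hQ (s, d s)
  have hconst := harmonic_const (M.detMatrix_mem_rowStochastic d) (hM d) hharm
  have h : ∀ x, Q x = maxAction Q y.1 := fun x => by
    rw [← hQ]
    simp only [transMax]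
    rw [Finset.sum_congr rfl fun s' _ => by rw [hconst s' y.1], ← Finset.sum_mul, M.trans_sum,
      one_mul, hQ]
  rw [h x, h y]

end MDP

/-! ### Solving the optimality equation by vanishing discount -/

namespace MDP

variable {S A : Type*} [Fintype S] [Fintype A] (M : MDP S A)

/-- The reward as a table on state-action pairs. -/
def rewardTable (x : S × A) : ℝ := M.reward x.1 x.2

lemma norm_rewardTable_le : ‖M.rewardTable‖ ≤ 1 :=
  (pi_norm_le_iff_of_nonneg zero_le_one).2 fun x => by
    rw [Real.norm_eq_abs, rewardTable, abs_of_nonneg (M.reward_nonneg _ _)]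
    exact M.reward_le_one _ _

variable [Nonempty A]

lemma continuous_transMax : Continuous M.transMax :=
  (LipschitzWith.of_dist_le' (K := 1) fun Q Q' => by
    rw [dist_eq_norm, dist_eq_norm, one_mul]; exact M.norm_transMax_sub_le Q Q').continuous

lemma norm_transMax_le (Q : S × A → ℝ) : ‖M.transMax Q‖ ≤ ‖Q‖ :=
  (pi_norm_le_iff_of_nonneg (norm_nonneg _)).2 fun _ =>
    M.abs_sum_trans_mul_le _ _ fun s' => abs_maxAction_le Q s'

/-- Normalized solutions of the discounted optimality equation. -/
lemma exists_discounted (x₀ : S × A) {γ : ℝ} (h0 : 0 ≤ γ) (h1 : γ < 1) :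
    ∃ (Q : S × A → ℝ) (t : ℝ), Q x₀ = 0 ∧ |t| ≤ 1 ∧
      Q = γ • (M.rewardTable + M.transMax Q) - fun _ => t := by
  have hc : ContractingWith ⟨γ, h0⟩ fun Q : S × A → ℝ => γ • (M.rewardTable + M.transMax Q) := by
    refine ⟨by exact_mod_cast h1, LipschitzWith.of_dist_le_mul fun Q Q' => ?_⟩
    rw [dist_eq_norm, dist_eq_norm, ← smul_sub, add_sub_add_left_eq_sub, norm_smul,
      Real.norm_of_nonneg h0]
    exact mul_le_mul_of_nonneg_left (M.norm_transMax_sub_le Q Q') h0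
  set Q := hc.fixedPoint with hQ
  have hfix : γ • (M.rewardTable + M.transMax Q) = Q := hc.fixedPoint_isFixedPt
  have hnorm : (1 - γ) * ‖Q‖ ≤ 1 := by
    have : ‖Q‖ ≤ γ * (1 + ‖Q‖) := by
      conv_lhs => rw [← hfix]
      rw [norm_smul, Real.norm_of_nonneg h0]
      exact mul_le_mul_of_nonneg_left ((norm_add_le _ _).trans
        (add_le_add M.norm_rewardTable_le (M.norm_transMax_le Q))) h0
    linarith
  -- Normalizing the fixed point at `x₀` leaves the defect `(1 - γ) Q x₀`, which stays bounded as `γ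
  -- → 1` because rewards are at most 1.
  refine ⟨Q + fun _ => -Q x₀, (1 - γ) * Q x₀, by simp, ?_, ?_⟩
  · rw [abs_mul, abs_of_pos (sub_pos.2 h1)]
    exact (mul_le_mul_of_nonneg_left (norm_le_pi_norm Q x₀) (sub_pos.2 h1).le).trans hnorm
  · rw [transMax_add_const]
    ext x
    have := congrFun hfix x
    simp only [Pi.smul_apply, Pi.add_apply, Pi.sub_apply, smul_eq_mul] at this ⊢
    linarith

open Filter Topology in
/-- The average-reward optimality equation of a unichain MDP has a solution. -/
theorem exists_bellman_eq [DecidableEq S] [Nonempty S] (hM : M.Unichain) :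
    ∃ (v : ℝ) (Q : S × A → ℝ), M.bellman v Q = Q := by
  obtain ⟨x₀⟩ : Nonempty (S × A) := inferInstance
  let γ : ℕ → ℝ := fun k => 1 - 1 / ((k : ℝ) + 1)
  have hγ : Tendsto γ atTop (𝓝 1) := by
    simpa only [sub_zero] using
      tendsto_const_nhds.sub (tendsto_one_div_add_atTop_nhds_zero_nat (𝕜 := ℝ))
  have hγ0 : ∀ k, 0 ≤ γ k := fun k => by
    have : 1 / ((k : ℝ) + 1) ≤ 1 := by
      rw [div_le_one (by positivity)]; linarith [(Nat.cast_nonneg k : (0 : ℝ) ≤ k)]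
    simp only [γ]; linarith
  have hγ1 : ∀ k, γ k < 1 := fun k => by
    have : 0 < 1 / ((k : ℝ) + 1) := by positivity
    simp only [γ]; linarith
  choose Q t hQ0 ht hQ using fun k => M.exists_discounted x₀ (hγ0 k) (hγ1 k)
  -- If infinitely many normalized solutions stay bounded, a limit point solves the equation.
  -- Otherwise the norms tend to infinity; after rescaling to norm 1 the rewards and the defects
  -- disappear, and a limit point is a fixed point of `transMax` of norm 1 vanishing at `x₀`. The
  -- unichain assumption makes it constant, hence 0.
  by_cases hb : ∃ R, ∃ᶠ k in atTop, ‖Q k‖ ≤ R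
  · obtain ⟨R, hR⟩ := hb
    obtain ⟨⟨Q', t'⟩, -, φ, hφ, hlim⟩ := tendsto_subseq_of_frequently_bounded
      (Metric.isBounded_closedBall (x := (0 : (S × A → ℝ) × ℝ)) (r := max R 1))
      (x := fun k => (Q k, t k)) (hR.mono fun k hk => by
        rw [mem_closedBall_zero_iff, Prod.norm_def]
        exact max_le_max hk (ht k))
    have hQlim : Tendsto (fun k => Q (φ k)) atTop (𝓝 Q') := (continuous_fst.tendsto _).comp hlim
    have htlim : Tendsto (fun k => t (φ k)) atTop (𝓝 t') := (continuous_snd.tendsto _).comp hlim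
    have hlim2 : Tendsto (fun k => Q (φ k)) atTop
        (𝓝 ((1 : ℝ) • (M.rewardTable + M.transMax Q') - fun _ => t')) := by
      rw [show (fun k => Q (φ k)) = fun k => γ (φ k) • (M.rewardTable + M.transMax (Q (φ k))) -
        fun _ => t (φ k) from funext fun k => hQ (φ k)]
      refine ((hγ.comp hφ.tendsto_atTop).smul (tendsto_const_nhds.add
        ((M.continuous_transMax.tendsto _).comp hQlim))).sub ?_
      exact tendsto_pi_nhds.2 fun _ => htlim
    refine ⟨t', Q', ?_⟩
    conv_rhs => rw [tendsto_nhds_unique hQlim hlim2]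
    ext x
    simp [bellman_apply, rewardTable]
  · exfalso
    have hinf : Tendsto (fun k => ‖Q k‖) atTop atTop := by
      refine tendsto_atTop.2 fun R => ?_
      by_contra h
      exact hb ⟨R, (not_eventually.1 h).mono fun k hk => (not_le.1 hk).le⟩
    obtain ⟨w, -, φ, hφ, hw⟩ := tendsto_subseq_of_bounded
      (Metric.isBounded_closedBall (x := (0 : S × A → ℝ)) (r := 1))
      (x := fun k => ‖Q k‖⁻¹ • Q k) (fun k => by
        rw [mem_closedBall_zero_iff, norm_smul, norm_inv, norm_norm]
        exact inv_mul_le_one)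
    have hinfφ : Tendsto (fun k => ‖Q (φ k)‖) atTop atTop := hinf.comp hφ.tendsto_atTop
    have hinv : Tendsto (fun k => ‖Q (φ k)‖⁻¹) atTop (𝓝 0) := tendsto_inv_atTop_zero.comp hinfφ
    have hnorm : ‖w‖ = 1 := by
      refine tendsto_nhds_unique hw.norm (tendsto_const_nhds.congr' ?_)
      filter_upwards [hinfφ.eventually_gt_atTop 0] with k hk
      simp [norm_smul, hk.ne']
    have hw0 : w x₀ = 0 := by
      refine tendsto_nhds_unique ((tendsto_pi_nhds.1 hw) x₀) ?_
      simp [hQ0]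
    have hlim2 : Tendsto ((fun k => ‖Q k‖⁻¹ • Q k) ∘ φ) atTop
        (𝓝 ((1 : ℝ) • ((0 : ℝ) • M.rewardTable + M.transMax w) - 0)) := by
      have hz : Tendsto (fun k => ‖Q (φ k)‖⁻¹ • (fun _ : S × A => t (φ k))) atTop (𝓝 0) := by
        refine tendsto_pi_nhds.2 fun x => squeeze_zero_norm (fun k => ?_) hinv
        rw [Pi.smul_apply, smul_eq_mul, norm_mul, norm_inv, norm_norm]
        exact mul_le_of_le_one_right (inv_nonneg.2 (norm_nonneg _)) (ht _)
      refine (((hγ.comp hφ.tendsto_atTop).smul ((hinv.smul_const M.rewardTable).add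
        ((M.continuous_transMax.tendsto _).comp hw))).sub hz).congr fun k => ?_
      have hk := hQ (φ k)
      simp only [Function.comp_apply]
      rw [M.transMax_smul _ (inv_nonneg.2 (norm_nonneg _))]
      conv_rhs => rw [hk]
      rw [smul_sub, smul_comm, smul_add, ← hk]
      simp only [smul_add]
    have hfix : M.transMax w = w := by
      have := tendsto_nhds_unique hw hlim2
      rw [one_smul, zero_smul, zero_add, sub_zero] at this
      exact this.symm
    have : w = 0 := by
      ext x
      rw [M.const_of_transMax_eq hM hfix x x₀, hw0]; rfl
    rw [this, norm_zero] at hnorm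
    exact zero_ne_one hnorm

end MDP

/-! ### The constant of the optimality equation is the optimal average reward -/

lemma abs_mulVec_le_of_mem_rowStochastic {S : Type*} [Fintype S] [DecidableEq S]
    {P : Matrix S S ℝ} (hP : P ∈ Matrix.rowStochastic ℝ S) {g : S → ℝ} {c : ℝ}
    (hg : ∀ s, |g s| ≤ c) (s : S) : |P.mulVec g s| ≤ c := by
  calc |P.mulVec g s| ≤ ∑ t, |P s t * g t| := Finset.abs_sum_le_sum_abs _ _
    _ ≤ ∑ t, P s t * c := Finset.sum_le_sum fun t _ => by
        rw [abs_mul, abs_of_nonneg (Matrix.nonneg_of_mem_rowStochastic hP)]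
        exact mul_le_mul_of_nonneg_left (hg t) (Matrix.nonneg_of_mem_rowStochastic hP)
    _ = c := by rw [← Finset.sum_mul, Matrix.sum_row_of_mem_rowStochastic hP, one_mul]

lemma mulVec_mono_of_mem_rowStochastic {S : Type*} [Fintype S] [DecidableEq S]
    {P : Matrix S S ℝ} (hP : P ∈ Matrix.rowStochastic ℝ S) {g h : S → ℝ} (hgh : ∀ s, g s ≤ h s)
    (s : S) : P.mulVec g s ≤ P.mulVec h s :=
  Finset.sum_le_sum fun t _ =>
    mul_le_mul_of_nonneg_left (hgh t) (Matrix.nonneg_of_mem_rowStochastic hP)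

lemma mulVec_const_of_mem_rowStochastic {S : Type*} [Fintype S] [DecidableEq S]
    {P : Matrix S S ℝ} (hP : P ∈ Matrix.rowStochastic ℝ S) (c : ℝ) (s : S) :
    P.mulVec (fun _ => c) s = c := by
  simp only [Matrix.mulVec, dotProduct, ← Finset.sum_mul, Matrix.sum_row_of_mem_rowStochastic hP,
    one_mul]

namespace MDP

variable {S A : Type*} [Fintype S] [Fintype A]

/-- Expected one-step reward of a policy. -/
def policyReward (M : MDP S A) (π : Policy S A) (s : S) : ℝ := ∑ a, π.prob s a * M.reward s a

lemma policyReward_add_mulVec (M : MDP S A) (π : Policy S A) (g : S → ℝ) (t : S) :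
    M.policyReward π t + (M.policyMatrix π).mulVec g t =
      ∑ a, π.prob t a * (M.reward t a + ∑ s', M.trans t a s' * g s') := by
  simp only [policyReward, policyMatrix, Matrix.mulVec, dotProduct, Matrix.of_apply, mul_add,
    Finset.sum_add_distrib, Finset.sum_mul, Finset.mul_sum]
  rw [Finset.sum_comm (s := Finset.univ (α := S))]
  simp only [mul_assoc]

variable [DecidableEq S] (M : MDP S A) (π : Policy S A)

lemma policyMatrix_mem_rowStochastic : M.policyMatrix π ∈ Matrix.rowStochastic ℝ S := by
  refine Matrix.mem_rowStochastic_iff_sum.2 ⟨fun s s' => Finset.sum_nonneg fun a _ =>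
    mul_nonneg (π.prob_nonneg s a) (M.trans_nonneg s a s'), fun s => ?_⟩
  simp only [policyMatrix, Matrix.of_apply]
  rw [Finset.sum_comm]
  simp only [← Finset.mul_sum, M.trans_sum, mul_one, π.prob_sum]

lemma expectedReward_eq (s : S) (k : ℕ) :
    M.expectedReward π s k = (M.policyMatrix π ^ k).mulVec (M.policyReward π) s := rfl

/-- The average of the expected rewards over the first `N` steps. -/
def meanReward (s : S) (N : ℕ) : ℝ :=
  (1 / (N : ℝ)) * ∑ k ∈ Finset.range N, M.expectedReward π s k

lemma meanReward_nonneg (s : S) (N : ℕ) : 0 ≤ M.meanReward π s N := by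
  refine mul_nonneg (by positivity) (Finset.sum_nonneg fun k _ => Finset.sum_nonneg fun t _ =>
    mul_nonneg (Matrix.nonneg_of_mem_rowStochastic (pow_mem (M.policyMatrix_mem_rowStochastic π) k))
      (Finset.sum_nonneg fun a _ => mul_nonneg (π.prob_nonneg t a) (M.reward_nonneg t a)))

/-- Applying `P ^ k` to the one-step inequality and summing over `k` telescopes the terms in `g`;
the two boundary terms give `2 * c / N`. -/
lemma meanReward_le {v c : ℝ} {g : S → ℝ} (hg : ∀ s, |g s| ≤ c)
    (h : ∀ t, M.policyReward π t + (M.policyMatrix π).mulVec g t ≤ g t + v) (s : S) {N : ℕ}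
    (hN : 0 < N) : M.meanReward π s N ≤ v + 2 * c * (1 / (N : ℝ)) := by
  have hP := M.policyMatrix_mem_rowStochastic π
  set P := M.policyMatrix π
  have hstep : ∀ k, M.expectedReward π s k ≤
      v + ((P ^ k).mulVec g s - (P ^ (k + 1)).mulVec g s) := fun k => by
    have h1 := mulVec_mono_of_mem_rowStochastic (pow_mem hP k) (g := M.policyReward π + P.mulVec g)
      (h := g + fun _ => v) h s
    rw [Matrix.mulVec_add, Matrix.mulVec_add, Matrix.mulVec_mulVec, ← pow_succ, Pi.add_apply,
      Pi.add_apply, mulVec_const_of_mem_rowStochastic (pow_mem hP k)] at h1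
    rw [expectedReward_eq]
    linarith
  have hsum : ∑ k ∈ Finset.range N, M.expectedReward π s k ≤ N * v + 2 * c := by
    refine (Finset.sum_le_sum fun k _ => hstep k).trans ?_
    rw [Finset.sum_add_distrib, Finset.sum_range_sub', Finset.sum_const, Finset.card_range,
      nsmul_eq_mul]
    have h1 := abs_le.1 (abs_mulVec_le_of_mem_rowStochastic (pow_mem hP 0) hg s)
    have h2 := abs_le.1 (abs_mulVec_le_of_mem_rowStochastic (pow_mem hP N) hg s)
    linarith
  have hN' : (0 : ℝ) < N := Nat.cast_pos.2 hN
  calc M.meanReward π s N ≤ (1 / (N : ℝ)) * (N * v + 2 * c) :=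
        mul_le_mul_of_nonneg_left hsum (by positivity)
    _ = v + 2 * c * (1 / (N : ℝ)) := by field_simp

lemma le_meanReward {v c : ℝ} {g : S → ℝ} (hg : ∀ s, |g s| ≤ c)
    (h : ∀ t, g t + v ≤ M.policyReward π t + (M.policyMatrix π).mulVec g t) (s : S) {N : ℕ}
    (hN : 0 < N) : v - 2 * c * (1 / (N : ℝ)) ≤ M.meanReward π s N := by
  have hP := M.policyMatrix_mem_rowStochastic π
  set P := M.policyMatrix π
  have hstep : ∀ k, v + ((P ^ k).mulVec g s - (P ^ (k + 1)).mulVec g s) ≤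
      M.expectedReward π s k := fun k => by
    have h1 := mulVec_mono_of_mem_rowStochastic (pow_mem hP k) (h := M.policyReward π + P.mulVec g)
      (g := g + fun _ => v) h s
    rw [Matrix.mulVec_add, Matrix.mulVec_add, Matrix.mulVec_mulVec, ← pow_succ, Pi.add_apply,
      Pi.add_apply, mulVec_const_of_mem_rowStochastic (pow_mem hP k)] at h1
    rw [expectedReward_eq]
    linarith
  have hsum : N * v - 2 * c ≤ ∑ k ∈ Finset.range N, M.expectedReward π s k := by
    refine le_trans ?_ (Finset.sum_le_sum fun k _ => hstep k)
    rw [Finset.sum_add_distrib, Finset.sum_range_sub', Finset.sum_const, Finset.card_range,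
      nsmul_eq_mul]
    have h1 := abs_le.1 (abs_mulVec_le_of_mem_rowStochastic (pow_mem hP 0) hg s)
    have h2 := abs_le.1 (abs_mulVec_le_of_mem_rowStochastic (pow_mem hP N) hg s)
    linarith
  have hN' : (0 : ℝ) < N := Nat.cast_pos.2 hN
  calc v - 2 * c * (1 / (N : ℝ)) = (1 / (N : ℝ)) * (N * v - 2 * c) := by field_simp
    _ ≤ M.meanReward π s N := mul_le_mul_of_nonneg_left hsum (by positivity)

open Filter Topology in
lemma avgReward_le {v c : ℝ} {g : S → ℝ} (hg : ∀ s, |g s| ≤ c)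
    (h : ∀ t, M.policyReward π t + (M.policyMatrix π).mulVec g t ≤ g t + v) (s : S) :
    M.avgReward π s ≤ v := by
  have hlim : Tendsto (fun N : ℕ => v + 2 * c * (1 / (N : ℝ))) atTop (𝓝 v) := by
    simpa using tendsto_const_nhds.add (tendsto_one_div_atTop_nhds_zero_nat.const_mul (2 * c))
  rw [← hlim.liminf_eq]
  refine liminf_le_liminf ?_ ?_ ?_
  · filter_upwards [eventually_gt_atTop 0] with N hN
    exact M.meanReward_le π hg h s hN
  · exact isBoundedUnder_of ⟨0, fun N => M.meanReward_nonneg π s N⟩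
  · exact hlim.isCoboundedUnder_ge

open Filter Topology in
lemma avgReward_eq {v c : ℝ} {g : S → ℝ} (hg : ∀ s, |g s| ≤ c)
    (h : ∀ t, M.policyReward π t + (M.policyMatrix π).mulVec g t = g t + v) (s : S) :
    M.avgReward π s = v := by
  have hlim : Tendsto (fun N : ℕ => 2 * c * (1 / (N : ℝ))) atTop (𝓝 0) := by
    simpa using tendsto_one_div_atTop_nhds_zero_nat.const_mul (2 * c)
  refine Tendsto.liminf_eq (tendsto_of_tendsto_of_tendsto_of_le_of_le'
    (g := fun N : ℕ => v - 2 * c * (1 / (N : ℝ))) (h := fun N : ℕ => v + 2 * c * (1 / (N : ℝ)))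
    (by simpa using tendsto_const_nhds.sub hlim) (by simpa using tendsto_const_nhds.add hlim)
    ?_ ?_)
  · filter_upwards [eventually_gt_atTop 0] with N hN
    exact M.le_meanReward π hg (fun t => (h t).ge) s hN
  · filter_upwards [eventually_gt_atTop 0] with N hN
    exact M.meanReward_le π hg (fun t => (h t).le) s hN

/-- The constant in any solution of the optimality equation is the optimal average reward. -/
theorem optValue_eq_of_bellman_eq [Nonempty A] {v : ℝ} {Q : S × A → ℝ} (hQ : M.bellman v Q = Q)
    (s : S) : M.optValue s = v := by
  have hval : ∀ t a, M.reward t a + ∑ s', M.trans t a s' * maxAction Q s' = Q (t, a) + v :=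
    fun t a => by
      have := congrFun hQ (t, a)
      rw [bellman_apply] at this
      simp only [transMax] at this
      linarith
  -- Any policy averages the action values, so it cannot exceed their maximum; the greedy policy
  -- below attains it.
  have hle : ∀ π : Policy S A, M.avgReward π s ≤ v := fun π => by
    refine M.avgReward_le π (abs_maxAction_le Q) (fun t => ?_) s
    rw [policyReward_add_mulVec]
    calc _ ≤ ∑ a, π.prob t a * (maxAction Q t + v) := Finset.sum_le_sum fun a _ => by
          rw [hval]
          exact mul_le_mul_of_nonneg_left (by linarith [le_maxAction Q t a]) (π.prob_nonneg t a)
      _ = _ := by rw [← Finset.sum_mul, π.prob_sum, one_mul]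
  classical
  choose d hd using exists_eq_maxAction Q
  let π : Policy S A :=
    { prob := fun s a => if a = d s then 1 else 0
      prob_nonneg := fun s a => by split_ifs <;> norm_num
      prob_sum := fun s => by simp }
  have hπ : M.avgReward π s = v := by
    refine M.avgReward_eq π (abs_maxAction_le Q) (fun t => ?_) s
    rw [policyReward_add_mulVec]
    simp only [hval, π, ite_mul, one_mul, zero_mul, Finset.sum_ite_eq', Finset.mem_univ, if_true,
      hd]
  have : Nonempty (Policy S A) := ⟨π⟩
  exact le_antisymm (ciSup_le hle) (hπ ▸ le_ciSup (f := fun π => M.avgReward π s)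
    ⟨v, by rintro _ ⟨π', rfl⟩; exact hle π'⟩ π)

/-- In a unichain MDP the optimality operator with the optimal average reward has a fixed point. -/
theorem exists_bellman_optValue_eq [Nonempty A] (hM : M.Unichain) (s : S) :
    ∃ Q : S × A → ℝ, M.bellman (M.optValue s) Q = Q := by
  have : Nonempty S := ⟨s⟩
  obtain ⟨v, Q, hQ⟩ := M.exists_bellman_eq hM
  exact ⟨Q, by rw [M.optValue_eq_of_bellman_eq hQ s, hQ]⟩

/-- The optimal average reward of a unichain MDP lies in `[0,1]`. -/
lemma optValue_mem_Icc [Nonempty A] (hM : M.Unichain) (s : S) :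
    M.optValue s ∈ Set.Icc (0 : ℝ) 1 := by
  have : Nonempty S := ⟨s⟩
  obtain ⟨Q, hQ⟩ := M.exists_bellman_optValue_eq hM s
  have hv : ∀ x : S × A, M.optValue s = M.reward x.1 x.2 + M.transMax Q x - Q x := fun x => by
    have := congrFun hQ x
    rw [bellman_apply] at this
    linarith
  -- At a maximizer of `Q`, `transMax Q ≤ Q` gives `v ≤ r`; at a minimizer the reverse holds.
  obtain ⟨x, hx⟩ := Finite.exists_max Q
  obtain ⟨y, hy⟩ := Finite.exists_min Q
  have hux : M.transMax Q x ≤ Q x := by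
    calc M.transMax Q x ≤ ∑ s', M.trans x.1 x.2 s' * Q x := Finset.sum_le_sum fun s' _ =>
          mul_le_mul_of_nonneg_left (maxAction_le fun a => hx (s', a)) (M.trans_nonneg _ _ _)
      _ = Q x := by rw [← Finset.sum_mul, M.trans_sum, one_mul]
  have hly : Q y ≤ M.transMax Q y := by
    calc Q y = ∑ s', M.trans y.1 y.2 s' * Q y := by rw [← Finset.sum_mul, M.trans_sum, one_mul]
      _ ≤ M.transMax Q y := Finset.sum_le_sum fun s' _ =>
          mul_le_mul_of_nonneg_left ((hy (s', Classical.arbitrary A)).trans (le_maxAction Q s' _))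
            (M.trans_nonneg _ _ _)
  constructor
  · rw [hv y]; linarith [M.reward_nonneg y.1 y.2]
  · rw [hv x]; linarith [M.reward_le_one x.1 x.2]

end MDP

/-! ### Maximal inequality and freezing of an independent variable -/

section Maximal

variable {Ω : Type*} [MeasurableSpace Ω] {μ : Measure Ω} [IsProbabilityMeasure μ]

/-- Maximal inequality for a finite family of sub-Gaussian random variables. -/
lemma integral_norm_le_of_hasSubgaussianMGF {ι : Type*} [Fintype ι] [Nonempty ι]
    {W : ι → Ω → ℝ} {c : NNReal} (hW : ∀ i, HasSubgaussianMGF (W i) c μ) {t : ℝ} (ht : 0 < t) :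
    ∫ ω, ‖fun i => W i ω‖ ∂μ ≤ Real.log (2 * Fintype.card ι) / t + c * t / 2 := by
  have hm : (0 : ℝ) < Fintype.card ι := Nat.cast_pos.2 Fintype.card_pos
  -- `a` bounds the mean of the sum of exponentials. The tangent bound `log y ≤ log a - 1 + y / a`,
  -- integrated, then gives `log a` without Jensen's inequality.
  set a : ℝ := 2 * Fintype.card ι * Real.exp (c * t ^ 2 / 2) with ha
  have ha0 : 0 < a := by positivity
  have hlog : Real.log a = Real.log (2 * Fintype.card ι) + c * t ^ 2 / 2 := by
    rw [ha, Real.log_mul (by positivity) (Real.exp_pos _).ne', Real.log_exp]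
  have hpt : ∀ ω, t * ‖fun i => W i ω‖ ≤ Real.log a - 1 +
      (∑ i, (Real.exp (t * W i ω) + Real.exp (-t * W i ω))) / a := fun ω => by
    obtain ⟨i, hi⟩ : ∃ i, ‖fun i => W i ω‖ = |W i ω| := by
      obtain ⟨i, hi⟩ := Finite.exists_max fun i => |W i ω|
      exact ⟨i, le_antisymm ((pi_norm_le_iff_of_nonneg (abs_nonneg _)).2 hi)
        (norm_le_pi_norm (fun i => W i ω) i)⟩
    have h1 := Real.add_one_le_exp (t * ‖fun i => W i ω‖ - Real.log a)
    rw [Real.exp_sub, Real.exp_log ha0] at h1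
    have h2 : Real.exp (t * ‖fun i => W i ω‖) ≤
        ∑ i, (Real.exp (t * W i ω) + Real.exp (-t * W i ω)) := by
      refine le_trans ?_ (Finset.single_le_sum
        (f := fun i => Real.exp (t * W i ω) + Real.exp (-t * W i ω))
        (fun j _ => by positivity) (Finset.mem_univ i))
      rw [hi]
      rcases abs_cases (W i ω) with ⟨h, -⟩ | ⟨h, -⟩
      · rw [h]; exact le_add_of_nonneg_right (Real.exp_pos _).le
      · rw [h, mul_neg, ← neg_mul]; exact le_add_of_nonneg_left (Real.exp_pos _).le
    have h3 := div_le_div_of_nonneg_right h2 ha0.le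
    linarith
  have hint : Integrable (fun ω => ‖fun i => W i ω‖) μ := by
    refine Integrable.mono' (g := fun ω => ∑ i, |W i ω|)
      (integrable_finsetSum _ fun i _ => (hW i).integrable.abs)
      (aemeasurable_pi_lambda _ fun i => (hW i).aemeasurable).norm.aestronglyMeasurable
      (ae_of_all _ fun ω => ?_)
    rw [norm_norm]
    exact (pi_norm_le_iff_of_nonneg (Finset.sum_nonneg fun i _ => abs_nonneg _)).2 fun i =>
      Finset.single_le_sum (f := fun i => |W i ω|) (fun j _ => abs_nonneg _) (Finset.mem_univ i)
  have hexp : ∀ i, Integrable (fun ω => Real.exp (t * W i ω) + Real.exp (-t * W i ω)) μ :=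
    fun i => ((hW i).integrable_exp_mul t).add ((hW i).integrable_exp_mul (-t))
  have hbd : ∀ i, ∫ ω, (Real.exp (t * W i ω) + Real.exp (-t * W i ω)) ∂μ ≤
      2 * Real.exp (c * t ^ 2 / 2) := fun i => by
    rw [integral_add ((hW i).integrable_exp_mul t) ((hW i).integrable_exp_mul (-t))]
    have h1 := (hW i).mgf_le t
    have h2 := (hW i).mgf_le (-t)
    rw [neg_sq] at h2
    simp only [mgf] at h1 h2
    linarith
  have hsum : ∫ ω, (∑ i, (Real.exp (t * W i ω) + Real.exp (-t * W i ω))) / a ∂μ ≤ 1 := by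
    rw [integral_div, integral_finsetSum _ fun i _ => hexp i, div_le_one ha0]
    refine (Finset.sum_le_sum fun i _ => hbd i).trans ?_
    rw [Finset.sum_const, Finset.card_univ, nsmul_eq_mul, ha]
    exact le_of_eq (by ring)
  have hmain : t * ∫ ω, ‖fun i => W i ω‖ ∂μ ≤ Real.log a := by
    rw [← integral_const_mul]
    have hI : Integrable (fun ω => (∑ i, (Real.exp (t * W i ω) + Real.exp (-t * W i ω))) / a) μ :=
      (integrable_finsetSum _ fun i _ => hexp i).div_const a
    refine (integral_mono (hint.const_mul t) ((integrable_const _).add hI) hpt).trans ?_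
    simp only [Pi.add_apply]
    rw [integral_add (integrable_const _) hI, integral_const, probReal_univ, one_smul]
    linarith
  rw [hlog] at hmain
  have : ∫ ω, ‖fun i => W i ω‖ ∂μ ≤ (Real.log (2 * Fintype.card ι) + c * t ^ 2 / 2) / t := by
    rw [le_div_iff₀ ht]; linarith
  refine this.trans (le_of_eq ?_)
  field_simp

/-- An expectation over two independent discrete random variables is bounded by a uniform bound
for the expectations with the first variable frozen. -/
lemma integral_le_of_indepFun {α β : Type*} [Finite α] [Finite β] [MeasurableSpace α]
    [MeasurableSpace β] [MeasurableSingletonClass α] [MeasurableSingletonClass β]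
    {Y : Ω → α} {Z : Ω → β} (hY : Measurable Y) (hZ : Measurable Z) (hYZ : IndepFun Y Z μ)
    (h : α → β → ℝ) {K : ℝ} (hK : ∀ y, ∫ ω, h y (Z ω) ∂μ ≤ K) :
    ∫ ω, h (Y ω) (Z ω) ∂μ ≤ K := by
  have : IsProbabilityMeasure (μ.map Y) := Measure.isProbabilityMeasure_map hY.aemeasurable
  have : IsProbabilityMeasure (μ.map Z) := Measure.isProbabilityMeasure_map hZ.aemeasurable
  have hmap := (indepFun_iff_map_prod_eq_prod_map_map hY.aemeasurable hZ.aemeasurable).1 hYZ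
  have h1 : ∫ ω, h (Y ω) (Z ω) ∂μ = ∫ p, h p.1 p.2 ∂(μ.map fun ω => (Y ω, Z ω)) :=
    (integral_map (f := fun p : α × β => h p.1 p.2) (hY.prodMk hZ).aemeasurable
      (measurable_of_countable _).aestronglyMeasurable).symm
  rw [h1, hmap, integral_prod _ Integrable.of_finite]
  calc ∫ y, ∫ z, h y z ∂μ.map Z ∂μ.map Y ≤ ∫ _, K ∂μ.map Y := by
        refine integral_mono Integrable.of_finite Integrable.of_finite fun y => ?_
        rw [integral_map hZ.aemeasurable (measurable_of_countable _).aestronglyMeasurable]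
        exact hK y
    _ = K := by simp

end Maximal

/-! ### Concentration of a minibatch mean -/

section BatchError

variable {S A : Type*} [Fintype S] [MeasurableSpace S] [MeasurableSingletonClass S]
  {M : MDP S A} {Ω : Type*} [MeasurableSpace Ω] {μ : Measure Ω} [IsProbabilityMeasure μ]
  {X : ℕ → ℕ → S × A → Ω → S}

lemma MDP.IsSampling.integral_comp (hX : M.IsSampling μ X) (n i : ℕ) (x : S × A) (g : S → ℝ) :
    ∫ ω, g (X n i x ω) ∂μ = ∑ s', M.trans x.1 x.2 s' * g s' := by
  have := Measure.isProbabilityMeasure_map (μ := μ) (hX.measurable n i x).aemeasurable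
  rw [← integral_map (f := g) (hX.measurable n i x).aemeasurable
    (measurable_of_countable g).aestronglyMeasurable, integral_fintype Integrable.of_finite]
  refine Finset.sum_congr rfl fun s' _ => ?_
  rw [map_measureReal_apply (hX.measurable n i x) (measurableSet_singleton s'),
    ← hX.law n i x s', smul_eq_mul]
  rfl

/-- Expected sup-norm error of the minibatch estimate of `∑ s', p(s' | s, a) g(s')`. -/
lemma MDP.IsSampling.integral_batch_error_le [Fintype A] [Nonempty (S × A)]
    (hX : M.IsSampling μ X) (n : ℕ) {k : ℕ} (hk : 0 < k) {g : S → ℝ} {b : ℝ} (hb : 0 < b)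
    (hg : ∀ s, |g s| ≤ b) :
    ∫ ω, ‖fun x : S × A => (1 / (k : ℝ)) * ∑ i ∈ Finset.range k, g (X n i x ω) -
      ∑ s', M.trans x.1 x.2 s' * g s'‖ ∂μ ≤
      2 * b * √(Real.log (2 * Fintype.card (S × A))) / √k := by
  set L := Real.log (2 * Fintype.card (S × A)) with hL
  have hcard : (1 : ℝ) ≤ Fintype.card (S × A) := by exact_mod_cast Fintype.card_pos
  have hL0 : 0 < L := Real.log_pos (by linarith)
  have hk' : (0 : ℝ) < k := Nat.cast_pos.2 hk
  have hsub : ∀ x : S × A, HasSubgaussianMGF (fun ω => ∑ i ∈ Finset.range k,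
      (g (X n i x ω) - ∑ s', M.trans x.1 x.2 s' * g s')) (k * (‖b - -b‖₊ / 2) ^ 2) μ := fun x => by
    have h1 : ∀ i ∈ Finset.range k, HasSubgaussianMGF
        (fun ω => g (X n i x ω) - ∑ s', M.trans x.1 x.2 s' * g s') ((‖b - -b‖₊ / 2) ^ 2) μ :=
      fun i _ => by
        have := hasSubgaussianMGF_of_mem_Icc (μ := μ) (X := fun ω => g (X n i x ω)) (a := -b)
          (b := b) ((measurable_of_countable g).comp (hX.measurable n i x)).aemeasurable
          (ae_of_all _ fun ω => abs_le.1 (hg _))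
        rwa [hX.integral_comp] at this
    have h2 : iIndepFun (fun (i : ℕ) ω => g (X n i x ω) - ∑ s', M.trans x.1 x.2 s' * g s') μ := by
      have h3 := hX.indep.precomp (g := fun i : ℕ => (n, i)) (fun i j hij => (Prod.mk.inj hij).2)
      exact h3.comp (fun _ z => g (z x) - ∑ s', M.trans x.1 x.2 s' * g s') fun _ =>
        ((measurable_of_countable g).comp (measurable_pi_apply x)).sub_const _
    have h3 := HasSubgaussianMGF.sum_of_iIndepFun h2 h1
    simpa using h3
  have hc : ((k * (‖b - -b‖₊ / 2) ^ 2 : NNReal) : ℝ) = k * b ^ 2 := by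
    push_cast
    rw [sub_neg_eq_add, Real.norm_of_nonneg (by positivity)]
    ring
  -- Up to a factor `√2`, this `t` minimizes `L / t + k * b ^ 2 * t / 2`.
  have hmax := integral_norm_le_of_hasSubgaussianMGF hsub
    (t := √L / (b * √k)) (by positivity)
  rw [hc] at hmax
  have hscale : ∀ ω, ‖fun x : S × A => (1 / (k : ℝ)) * ∑ i ∈ Finset.range k, g (X n i x ω) -
      ∑ s', M.trans x.1 x.2 s' * g s'‖ = (1 / (k : ℝ)) * ‖fun x : S × A => ∑ i ∈ Finset.range k,
      (g (X n i x ω) - ∑ s', M.trans x.1 x.2 s' * g s')‖ := fun ω => by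
    rw [← Real.norm_of_nonneg (show 0 ≤ 1 / (k : ℝ) by positivity), ← norm_smul,
      Real.norm_of_nonneg (show 0 ≤ 1 / (k : ℝ) by positivity)]
    congr 1
    ext x
    simp only [Pi.smul_apply, smul_eq_mul, Finset.sum_sub_distrib, Finset.sum_const,
      Finset.card_range, nsmul_eq_mul]
    field_simp
  simp only [hscale]
  rw [integral_const_mul]
  have hLs : √L * √L = L := Real.mul_self_sqrt hL0.le
  have hks : √(k : ℝ) * √k = k := Real.mul_self_sqrt hk'.le
  have hsk : 0 < √(k : ℝ) := Real.sqrt_pos.2 hk'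
  have hsL : 0 < √L := Real.sqrt_pos.2 hL0
  have hval : ∀ l q : ℝ, 0 < l → 0 < q → 1 / (q * q) *
      (l * l / (l / (b * q)) + q * q * b ^ 2 * (l / (b * q)) / 2) = 3 / 2 * b * l / q :=
    fun l q hl hq => by
      field_simp
      ring
  have hval' := hval _ _ hsL hsk
  rw [hLs, hks] at hval'
  calc 1 / (k : ℝ) * _ ≤ 3 / 2 * b * √L / √k := by
        rw [← hval']
        exact mul_le_mul_of_nonneg_left hmax (by positivity)
    _ ≤ _ := by gcongr; norm_num

end BatchError

/-! ### The run with constant offset and its sampling errors -/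

lemma batchSize_mono : Monotone batchSize := fun _ _ h => Nat.pow_le_pow_left h 6

lemma halpernWeight_nonneg (n : ℕ) : 0 ≤ halpernWeight n := by
  unfold halpernWeight; positivity

lemma one_sub_halpernWeight (n : ℕ) : 1 - halpernWeight n = 1 / ((n : ℝ) + 1) := by
  unfold halpernWeight; field_simp; ring

lemma halpernWeight_le_one (n : ℕ) : halpernWeight n ≤ 1 := by
  have h := one_sub_halpernWeight n
  have : 0 ≤ 1 / ((n : ℝ) + 1) := by positivity
  linarith

section Sequences

variable {T : Type*}

/-- The indices of the samples drawn up to iteration `n`, together with some that are not used. -/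
def sampleIndices (n : ℕ) : Finset (ℕ × ℕ) := Finset.range (n + 1) ×ˢ Finset.range (batchSize n)

/-- Extension of a finite family of samples by a default value. -/
def extendSamples [Nonempty T] (F : Finset (ℕ × ℕ)) (y : F → T) : ℕ → ℕ → T := fun j i =>
  if h : (j, i) ∈ F then y ⟨(j, i), h⟩ else Classical.arbitrary T

lemma extendSamples_restrict [Nonempty T] {F : Finset (ℕ × ℕ)} (x : ℕ → ℕ → T) {j i : ℕ}
    (h : (j, i) ∈ F) : extendSamples F (fun p : F => x p.1.1 p.1.2) j i = x j i := by
  simp [extendSamples, h]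

lemma mem_sampleIndices {n j i : ℕ} (hj : j ≤ n) (hi : i < batchSize j) :
    (j, i) ∈ sampleIndices n :=
  Finset.mem_product.2 ⟨Finset.mem_range.2 (Nat.lt_succ_of_le hj),
    Finset.mem_range.2 (hi.trans_le (batchSize_mono hj))⟩

/-- `φ` depends only on the samples drawn up to iteration `n`. -/
def DependsOnSamples {β : Type*} (n : ℕ) (φ : (ℕ → ℕ → T) → β) : Prop :=
  ∀ x x' : ℕ → ℕ → T, (∀ j ≤ n, ∀ i < batchSize j, x j i = x' j i) → φ x = φ x'

lemma DependsOnSamples.mono {β : Type*} {n m : ℕ} (h : n ≤ m) {φ : (ℕ → ℕ → T) → β}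
    (hφ : DependsOnSamples n φ) : DependsOnSamples m φ :=
  fun x x' hx => hφ x x' fun j hj => hx j (hj.trans h)

end Sequences

namespace MDP

lemma IsSampling.measurable_family {S A : Type*} [Fintype S] {M : MDP S A} [MeasurableSpace S]
    {Ω : Type*} [MeasurableSpace Ω] {μ : Measure Ω} {X : ℕ → ℕ → S × A → Ω → S}
    (hX : M.IsSampling μ X) (F : Finset (ℕ × ℕ)) :
    Measurable fun ω (p : F) (y : S × A) => X p.1.1 p.1.2 y ω :=
  measurable_pi_lambda _ fun p => measurable_pi_lambda _ fun y => hX.measurable p.1.1 p.1.2 y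

/-- A function of finitely many samples is integrable. -/
lemma IsSampling.integrable {S A : Type*} [Fintype S] [Nonempty S] [Fintype A] {M : MDP S A}
    [MeasurableSpace S] [MeasurableSingletonClass S] {Ω : Type*} [MeasurableSpace Ω]
    {μ : Measure Ω} [IsProbabilityMeasure μ] {X : ℕ → ℕ → S × A → Ω → S} (hX : M.IsSampling μ X) {n : ℕ}
    {φ : (ℕ → ℕ → S × A → S) → ℝ} (hφ : DependsOnSamples n φ) :
    Integrable (fun ω => φ fun j i y => X j i y ω) μ := by
  -- `φ` factors through a finite family of samples with values in a finite set, where every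
  -- function is integrable.
  have heq : (fun ω => φ fun j i y => X j i y ω) =
      (fun z => φ (extendSamples (sampleIndices n) z)) ∘
        fun ω (p : sampleIndices n) (y : S × A) => X p.1.1 p.1.2 y ω := by
    ext ω
    refine hφ _ _ fun j hj i hi => ?_
    exact (extendSamples_restrict (fun j i y => X j i y ω) (mem_sampleIndices hj hi)).symm
  rw [heq]
  have hmeas := hX.measurable_family (sampleIndices n)
  have : IsProbabilityMeasure
      (μ.map fun ω (p : sampleIndices n) (y : S × A) => X p.1.1 p.1.2 y ω) :=
    Measure.isProbabilityMeasure_map hmeas.aemeasurable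
  exact Integrable.comp_measurable Integrable.of_finite hmeas

variable {S A : Type*} [Fintype S] [Fintype A] [Nonempty A] (M : MDP S A)

/-- Table after `n` iterations when the offset function is the constant `v`. -/
def centeredTable (v : ℝ) (Q₀ : S × A → ℝ) (n : ℕ) (x : ℕ → ℕ → S × A → S) : S × A → ℝ :=
  (M.run halpernWeight (fun _ => v) Q₀ x n).Q

/-- Sampling error of iteration `n + 1`. -/
def noise (v : ℝ) (Q₀ : S × A → ℝ) (n : ℕ) (x : ℕ → ℕ → S × A → S) : S × A → ℝ := fun y =>
  (1 / (batchSize (n + 1) : ℝ)) * ∑ i ∈ Finset.range (batchSize (n + 1)),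
    maxAction (M.centeredTable v Q₀ n x) (x (n + 1) i y) -
      ∑ s', M.trans y.1 y.2 s' * maxAction (M.centeredTable v Q₀ n x) s'

/-- The offset function changes the tables by constants only. -/
lemma exists_run_Q_eq_add_const {β : ℕ → ℝ} (v : ℝ) {f : (S × A → ℝ) → ℝ} (Q₀ : S × A → ℝ)
    (x : ℕ → ℕ → S × A → S) (hβ : ∀ n, batchSize n = 0 → β n = 0) (n : ℕ) :
    ∃ c : ℝ, (M.run β f Q₀ x n).Q = (M.run β (fun _ => v) Q₀ x n).Q + fun _ => c := by
  induction n with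
  | zero => exact ⟨0, by ext; simp [run]⟩
  | succ n ih =>
    obtain ⟨c, hc⟩ := ih
    refine ⟨β (n + 1) * (c + v - f (M.run β f Q₀ x n).Q), ?_⟩
    ext y
    simp only [run, Pi.add_apply]
    rw [hc]
    simp only [maxAction_add_const, Finset.sum_add_distrib, Finset.sum_const, Finset.card_range,
      nsmul_eq_mul]
    -- An empty batch would lose the constant `c`, but its weight is zero.
    by_cases h : batchSize (n + 1) = 0
    · rw [hβ _ h]; ring
    · have : (batchSize (n + 1) : ℝ) ≠ 0 := Nat.cast_ne_zero.2 h
      field_simp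
      ring

lemma calls_run (β : ℕ → ℝ) (f : (S × A → ℝ) → ℝ) (Q₀ : S × A → ℝ) (x : ℕ → ℕ → S × A → S)
    (n : ℕ) : (M.run β f Q₀ x n).calls ≤ Fintype.card (S × A) * n ^ 7 := by
  induction n with
  | zero => simp [run]
  | succ n ih =>
    simp only [run, Finset.sum_const, Finset.card_univ, smul_eq_mul]
    calc _ ≤ Fintype.card (S × A) * n ^ 7 + Fintype.card (S × A) * (n + 1) ^ 6 :=
          Nat.add_le_add_right ih _
      _ = Fintype.card (S × A) * (n * n ^ 6 + (n + 1) ^ 6) := by ring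
      _ ≤ Fintype.card (S × A) * (n * (n + 1) ^ 6 + (n + 1) ^ 6) := by gcongr; omega
      _ = Fintype.card (S × A) * (n + 1) ^ 7 := by ring

variable (v : ℝ) (Q₀ : S × A → ℝ)

lemma centeredTable_zero (x : ℕ → ℕ → S × A → S) : M.centeredTable v Q₀ 0 x = Q₀ := rfl

/-- This exhibits the run as a Halpern iteration of `bellman v` with errors `noise`. -/
lemma centeredTable_succ (n : ℕ) (x : ℕ → ℕ → S × A → S) :
    M.centeredTable v Q₀ (n + 1) x = (1 - halpernWeight (n + 1)) • Q₀ +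
      halpernWeight (n + 1) • (M.bellman v (M.centeredTable v Q₀ n x) + M.noise v Q₀ n x) := by
  ext y
  simp only [Pi.add_apply, Pi.smul_apply, smul_eq_mul, bellman_apply, noise, transMax]
  simp only [centeredTable, run]
  ring

lemma dependsOnSamples_centeredTable (n : ℕ) : DependsOnSamples n (M.centeredTable v Q₀ n) := by
  induction n with
  | zero => exact fun x x' _ => rfl
  | succ n ih =>
    intro x x' h
    have h1 := ih x x' fun j hj => h j (hj.trans n.le_succ)
    simp only [centeredTable] at h1
    ext y
    simp only [centeredTable, run, h1]
    rw [Finset.sum_congr rfl fun i hi => by rw [h (n + 1) le_rfl i (Finset.mem_range.1 hi)]]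

lemma dependsOnSamples_noise (n : ℕ) : DependsOnSamples (n + 1) (M.noise v Q₀ n) := by
  intro x x' h
  have h1 := M.dependsOnSamples_centeredTable v Q₀ n x x' fun j hj => h j (hj.trans n.le_succ)
  ext y
  simp only [noise, h1]
  rw [Finset.sum_congr rfl fun i hi => by rw [h (n + 1) le_rfl i (Finset.mem_range.1 hi)]]

variable {v}

/-- Since `|r - v| ≤ 1`, an iteration raises the bound by at most 1. The bound is pathwise, so it
supplies the range for the concentration estimate. -/
lemma norm_centeredTable_le (hv : v ∈ Set.Icc (0 : ℝ) 1) (n : ℕ) (x : ℕ → ℕ → S × A → S) :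
    ‖M.centeredTable v Q₀ n x‖ ≤ ‖Q₀‖ + n := by
  induction n with
  | zero => simp [centeredTable_zero]
  | succ n ih =>
    refine (pi_norm_le_iff_of_nonneg (by positivity)).2 fun y => ?_
    set Q := M.centeredTable v Q₀ n x with hQ
    set k := batchSize (n + 1) with hk
    have hk0 : (0 : ℝ) < k := Nat.cast_pos.2 (by rw [hk, batchSize]; positivity)
    have havg : |(1 / (k : ℝ)) * ∑ i ∈ Finset.range k, maxAction Q (x (n + 1) i y)| ≤ ‖Q‖ := by
      rw [abs_mul, abs_of_nonneg (by positivity : 0 ≤ 1 / (k : ℝ)), one_div, inv_mul_le_iff₀ hk0]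
      refine (Finset.abs_sum_le_sum_abs _ _).trans
        ((Finset.sum_le_sum fun i _ => abs_maxAction_le Q _).trans ?_)
      simp
    have hβ0 := halpernWeight_nonneg (n + 1)
    have hβ1 := halpernWeight_le_one (n + 1)
    have heq : M.centeredTable v Q₀ (n + 1) x y = (1 - halpernWeight (n + 1)) * Q₀ y +
        halpernWeight (n + 1) * (M.reward y.1 y.2 +
          (1 / (k : ℝ)) * ∑ i ∈ Finset.range k, maxAction Q (x (n + 1) i y) - v) := rfl
    have hr0 := M.reward_nonneg y.1 y.2
    have hr1 := M.reward_le_one y.1 y.2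
    have h1 : |M.reward y.1 y.2 + (1 / (k : ℝ)) * ∑ i ∈ Finset.range k,
        maxAction Q (x (n + 1) i y) - v| ≤ ‖Q₀‖ + (n + 1) := by
      have := abs_le.1 (havg.trans ih)
      exact abs_le.2 ⟨by linarith [hv.1, hv.2], by linarith [hv.1, hv.2]⟩
    have h2 : |Q₀ y| ≤ ‖Q₀‖ + (n + 1) := by
      have h := norm_le_pi_norm Q₀ y
      rw [Real.norm_eq_abs] at h
      linarith [(Nat.cast_nonneg n : (0 : ℝ) ≤ n)]
    rw [heq, Real.norm_eq_abs]
    refine (abs_add_le _ _).trans ?_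
    rw [abs_mul, abs_mul, abs_of_nonneg hβ0, abs_of_nonneg (sub_nonneg.2 hβ1)]
    have h3 := mul_le_mul_of_nonneg_left h1 hβ0
    have h4 := mul_le_mul_of_nonneg_left h2 (sub_nonneg.2 hβ1)
    push_cast
    linarith

section Sampling

variable {M} [MeasurableSpace S] [MeasurableSingletonClass S]
  {Ω : Type*} [MeasurableSpace Ω] {μ : Measure Ω} [IsProbabilityMeasure μ]
  {X : ℕ → ℕ → S × A → Ω → S}

/-- Expected sampling error of an iteration. -/
lemma IsSampling.integral_norm_noise_le [Nonempty S] (hX : M.IsSampling μ X)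
    (hv : v ∈ Set.Icc (0 : ℝ) 1) (n : ℕ) :
    ∫ ω, ‖M.noise v Q₀ n fun j i y => X j i y ω‖ ∂μ ≤
      2 * (‖Q₀‖ + 1) * √(Real.log (2 * Fintype.card (S × A))) / ((n : ℝ) + 1) ^ 2 := by
  -- The table of iteration `n` is a function of the samples in `F`, the fresh batch of those in
  -- `G`. Disjointness makes them independent, so the table can be frozen.
  set F := sampleIndices n with hF
  set G : Finset (ℕ × ℕ) := {n + 1} ×ˢ Finset.range (batchSize (n + 1)) with hG
  have hdisj : Disjoint F G := by
    refine Finset.disjoint_left.2 fun p hp hp' => ?_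
    have h1 := (Finset.mem_product.1 hp).1
    have h2 := (Finset.mem_product.1 hp').1
    rw [Finset.mem_range] at h1
    rw [Finset.mem_singleton] at h2
    omega
  have hind := hX.indep.indepFun_finset F G hdisj fun p =>
    measurable_pi_lambda _ fun y => hX.measurable p.1 p.2 y
  let h : (F → S × A → S) → (G → S × A → S) → ℝ := fun z w =>
    ‖fun y : S × A => (1 / (batchSize (n + 1) : ℝ)) * ∑ i ∈ Finset.range (batchSize (n + 1)),
      maxAction (M.centeredTable v Q₀ n (extendSamples F z)) (extendSamples G w (n + 1) i y) -
        ∑ s', M.trans y.1 y.2 s' * maxAction (M.centeredTable v Q₀ n (extendSamples F z)) s'‖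
  have hext : ∀ ω, ∀ i ∈ Finset.range (batchSize (n + 1)),
      extendSamples G (fun (p : G) (y : S × A) => X p.1.1 p.1.2 y ω) (n + 1) i =
        fun y => X (n + 1) i y ω := fun ω i hi =>
    extendSamples_restrict (fun j i y => X j i y ω)
      (Finset.mem_product.2 ⟨Finset.mem_singleton_self _, hi⟩)
  have heq : ∀ ω, ‖M.noise v Q₀ n fun j i y => X j i y ω‖ =
      h (fun p y => X p.1.1 p.1.2 y ω) (fun p y => X p.1.1 p.1.2 y ω) := fun ω => by
    have htab : M.centeredTable v Q₀ n
        (extendSamples F fun (p : F) (y : S × A) => X p.1.1 p.1.2 y ω) =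
        M.centeredTable v Q₀ n fun j i y => X j i y ω :=
      M.dependsOnSamples_centeredTable v Q₀ n _ _ fun j hj i hi =>
        extendSamples_restrict (fun j i y => X j i y ω) (mem_sampleIndices hj hi)
    simp only [h, htab]
    congr 1
    ext y
    simp only [noise]
    congr 2
    exact Finset.sum_congr rfl fun i hi => by rw [hext ω i hi]
  simp only [heq]
  refine integral_le_of_indepFun (hX.measurable_family F) (hX.measurable_family G) hind h
    fun z => ?_
  -- In product form, the factor `n + 1` cancels against the square root `(n + 1) ^ 3` of the batch
  -- size.
  have hb : 0 < (‖Q₀‖ + 1) * ((n : ℝ) + 1) := by positivity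
  have hg : ∀ s, |maxAction (M.centeredTable v Q₀ n (extendSamples F z)) s| ≤
      (‖Q₀‖ + 1) * ((n : ℝ) + 1) := fun s => by
    refine (abs_maxAction_le _ s).trans ((M.norm_centeredTable_le Q₀ hv n _).trans ?_)
    nlinarith [norm_nonneg Q₀, (Nat.cast_nonneg n : (0 : ℝ) ≤ n)]
  have hk : 0 < batchSize (n + 1) := by rw [batchSize]; positivity
  have hmain := hX.integral_batch_error_le (n + 1) hk hb hg
  have hsqrt : √(batchSize (n + 1) : ℝ) = ((n : ℝ) + 1) ^ 3 := by
    rw [batchSize, Real.sqrt_eq_iff_mul_self_eq (by positivity) (by positivity)]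
    push_cast
    ring
  rw [hsqrt] at hmain
  have hrw : ∀ ω, h z (fun p y => X p.1.1 p.1.2 y ω) = ‖fun y : S × A =>
      (1 / (batchSize (n + 1) : ℝ)) * ∑ i ∈ Finset.range (batchSize (n + 1)),
      maxAction (M.centeredTable v Q₀ n (extendSamples F z)) (X (n + 1) i y ω) -
        ∑ s', M.trans y.1 y.2 s' * maxAction (M.centeredTable v Q₀ n (extendSamples F z)) s'‖ :=
    fun ω => by
      simp only [h]
      congr 1
      ext y
      rw [Finset.sum_congr rfl fun i hi => by rw [hext ω i hi]]
  simp only [hrw]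
  refine hmain.trans (le_of_eq ?_)
  have : ((n : ℝ) + 1) ≠ 0 := by positivity
  field_simp

end Sampling

end MDP

/-! ### Halpern iteration of a nonexpansive map with errors -/

section Halpern

variable {E : Type*} [NormedAddCommGroup E] [NormedSpace ℝ E]

/-- `x` is a Halpern iteration of `T` with weights `n / (n + 1)` and errors `u`. -/
def IsHalpern (T : E → E) (x u : ℕ → E) : Prop :=
  ∀ n, x (n + 1) = (1 - halpernWeight (n + 1)) • x 0 + halpernWeight (n + 1) • (T (x n) + u n)

variable {T : E → E} {x u : ℕ → E} {z : E}

lemma IsHalpern.smul_eq (h : IsHalpern T x u) (n : ℕ) :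
    ((n : ℝ) + 2) • x (n + 1) = x 0 + ((n : ℝ) + 1) • (T (x n) + u n) := by
  rw [h n, one_sub_halpernWeight, smul_add, smul_smul, smul_smul, halpernWeight]
  push_cast
  have h1 : ((n : ℝ) + 2) * (1 / ((n : ℝ) + 1 + 1)) = 1 := by field_simp; ring
  have h2 : ((n : ℝ) + 2) * (((n : ℝ) + 1) / ((n : ℝ) + 1 + 1)) = (n : ℝ) + 1 := by
    field_simp; ring
  rw [h1, h2, one_smul]

lemma IsHalpern.norm_sub_fixed_le (h : IsHalpern T x u) (hT : ∀ a b, ‖T a - T b‖ ≤ ‖a - b‖)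
    (hz : T z = z) (n : ℕ) : ((n : ℝ) + 2) * ‖x (n + 1) - z‖ ≤
      ‖x 0 - z‖ + ((n : ℝ) + 1) * (‖x n - z‖ + ‖u n‖) := by
  have heq : ((n : ℝ) + 2) • (x (n + 1) - z) =
      (x 0 - z) + ((n : ℝ) + 1) • ((T (x n) - T z) + u n) := by
    rw [smul_sub, h.smul_eq, hz]; module
  rw [← Real.norm_of_nonneg (show (0 : ℝ) ≤ n + 2 by positivity), ← norm_smul, heq]
  refine (norm_add_le _ _).trans ?_
  rw [norm_smul, Real.norm_of_nonneg (show (0 : ℝ) ≤ n + 1 by positivity)]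
  gcongr
  exact (norm_add_le _ _).trans (add_le_add_left (hT _ _) _)

/-- Subtracting consecutive recursions makes `(n + 2) * ‖x (n + 1) - x n‖` a quantity that grows
only by the errors and by the change of weights, of order `1 / (n + 2)`. -/
lemma IsHalpern.norm_step_le (h : IsHalpern T x u) (hT : ∀ a b, ‖T a - T b‖ ≤ ‖a - b‖)
    (hz : T z = z) (n : ℕ) : ((n : ℝ) + 3) * ‖x (n + 2) - x (n + 1)‖ ≤
      ((n : ℝ) + 2) * (‖x (n + 1) - x n‖ + (‖u (n + 1)‖ + ‖u n‖)) +
        1 / ((n : ℝ) + 2) * (‖x n - z‖ + ‖u n‖ + ‖x 0 - z‖) := by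
  have hn : (n : ℝ) + 2 ≠ 0 := by positivity
  have h1 := h.smul_eq n
  have h2 := h.smul_eq (n + 1)
  push_cast at h2
  have heq : ((n : ℝ) + 3) • (x (n + 2) - x (n + 1)) =
      ((n : ℝ) + 2) • ((T (x (n + 1)) - T (x n)) + (u (n + 1) - u n)) +
        (1 / ((n : ℝ) + 2)) • ((T (x n) - T z) + u n - (x 0 - z)) := by
    have h3 : x (n + 1) = (1 / ((n : ℝ) + 2)) • (x 0 + ((n : ℝ) + 1) • (T (x n) + u n)) := by
      rw [← h1, smul_smul, one_div_mul_cancel hn, one_smul]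
    have h4 : ((n : ℝ) + 3) • x (n + 2) = x 0 + ((n : ℝ) + 2) • (T (x (n + 1)) + u (n + 1)) := by
      rw [show (n : ℝ) + 3 = n + 1 + 2 by ring, show (n : ℝ) + 2 = n + 1 + 1 by ring]
      exact h2
    rw [smul_sub, h4]
    nth_rw 2 [h3]
    rw [hz]
    match_scalars <;> field_simp <;> ring
  rw [← Real.norm_of_nonneg (show (0 : ℝ) ≤ n + 3 by positivity), ← norm_smul, heq]
  refine (norm_add_le _ _).trans ?_
  rw [norm_smul, norm_smul, Real.norm_of_nonneg (show (0 : ℝ) ≤ n + 2 by positivity),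
    Real.norm_of_nonneg (show (0 : ℝ) ≤ 1 / ((n : ℝ) + 2) by positivity)]
  gcongr
  · exact (norm_add_le _ _).trans (add_le_add (hT _ _) (norm_sub_le _ _))
  · exact (norm_sub_le _ _).trans
      (add_le_add_left ((norm_add_le _ _).trans (add_le_add_left (hT _ _) _)) _)

lemma IsHalpern.norm_first_step_le (h : IsHalpern T x u) (hT : ∀ a b, ‖T a - T b‖ ≤ ‖a - b‖)
    (hz : T z = z) : 2 * ‖x 1 - x 0‖ ≤ 2 * ‖x 0 - z‖ + ‖u 0‖ := by
  have heq : (2 : ℝ) • (x 1 - x 0) = ((T (x 0) - T z) - (x 0 - z)) + u 0 := by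
    have h1 := h.smul_eq 0
    simp only [Nat.cast_zero, zero_add, one_smul] at h1
    rw [smul_sub, h1, hz]
    module
  rw [← Real.norm_of_nonneg (show (0 : ℝ) ≤ 2 by norm_num), ← norm_smul, heq]
  refine (norm_add_le _ _).trans (add_le_add_left ((norm_sub_le _ _).trans ?_) _)
  rw [Real.norm_of_nonneg (show (0 : ℝ) ≤ 2 by norm_num)]
  linarith [hT (x 0) z]

/-- The recursion writes `(n + 2) • (T (x (n + 1)) - x (n + 1))` as `T (x (n + 1)) - x 0` plus `n +
1` times a step of `T` minus the error. -/
lemma IsHalpern.norm_residual_le (h : IsHalpern T x u) (hT : ∀ a b, ‖T a - T b‖ ≤ ‖a - b‖)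
    (hz : T z = z) (n : ℕ) : ((n : ℝ) + 2) * ‖T (x (n + 1)) - x (n + 1)‖ ≤
      (‖x (n + 1) - z‖ + ‖x 0 - z‖) + ((n : ℝ) + 1) * (‖x (n + 1) - x n‖ + ‖u n‖) := by
  have heq : ((n : ℝ) + 2) • (T (x (n + 1)) - x (n + 1)) =
      ((T (x (n + 1)) - T z) - (x 0 - z)) +
        ((n : ℝ) + 1) • ((T (x (n + 1)) - T (x n)) - u n) := by
    rw [smul_sub, h.smul_eq, hz]; module
  rw [← Real.norm_of_nonneg (show (0 : ℝ) ≤ n + 2 by positivity), ← norm_smul, heq]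
  refine (norm_add_le _ _).trans ?_
  rw [norm_smul, Real.norm_of_nonneg (show (0 : ℝ) ≤ n + 1 by positivity)]
  gcongr
  · exact (norm_sub_le _ _).trans (add_le_add_left (hT _ _) _)
  · exact (norm_sub_le _ _).trans (add_le_add_left (hT _ _) _)

lemma one_div_le_log_sub_log (n : ℕ) :
    1 / ((n : ℝ) + 2) ≤ Real.log ((n : ℝ) + 2) - Real.log ((n : ℝ) + 1) := by
  have h := Real.log_le_sub_one_of_pos (show 0 < ((n : ℝ) + 1) / ((n : ℝ) + 2) by positivity)
  rw [Real.log_div (by positivity) (by positivity)] at h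
  have : ((n : ℝ) + 1) / ((n : ℝ) + 2) - 1 = -(1 / ((n : ℝ) + 2)) := by field_simp; ring
  linarith

/-- Rate of the expected residual of a Halpern iteration with random errors. -/
lemma integral_residual_le {Ω : Type*} [MeasurableSpace Ω] {μ : Measure Ω} [IsProbabilityMeasure μ]
    {x u : ℕ → Ω → E} {x₀ : E} {D K : ℝ} (hT : ∀ a b, ‖T a - T b‖ ≤ ‖a - b‖) (hz : T z = z)
    (hx : ∀ ω, IsHalpern T (fun n => x n ω) fun n => u n ω) (hx₀ : ∀ ω, x 0 ω = x₀)
    (hD : ‖x₀ - z‖ ≤ D) (hia : ∀ n, Integrable (fun ω => ‖x n ω - z‖) μ)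
    (hid : ∀ n, Integrable (fun ω => ‖x (n + 1) ω - x n ω‖) μ)
    (hiu : ∀ n, Integrable (fun ω => ‖u n ω‖) μ)
    (hie : ∀ n, Integrable (fun ω => ‖T (x n ω) - x n ω‖) μ)
    (hu : ∀ n : ℕ, ∫ ω, ‖u n ω‖ ∂μ ≤ K / ((n : ℝ) + 1) ^ 2) (n : ℕ) :
    ((n : ℝ) + 2) * ∫ ω, ‖T (x (n + 1) ω) - x (n + 1) ω‖ ∂μ ≤
      9 * (D + K) * (1 + Real.log ((n : ℝ) + 1)) := by
  have hD0 : 0 ≤ D := (norm_nonneg _).trans hD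
  have hK0 : 0 ≤ K := by
    have := (integral_nonneg fun ω => norm_nonneg (u 0 ω)).trans (hu 0)
    simpa using this
  have ha0 : ∫ ω, ‖x 0 ω - z‖ ∂μ ≤ D := by simpa [hx₀] using hD
  have hcD : Integrable (fun _ : Ω => D) μ := integrable_const _
  have hintD : ∫ _, D ∂μ = D := by simp
  -- The induction closes because the weighted error `(n + 1) * K / (n + 1) ^ 2` is at most `K`.
  have ha : ∀ n, ∫ ω, ‖x n ω - z‖ ∂μ ≤ D + K := by
    intro n
    induction n with
    | zero => linarith
    | succ n ih =>
      have h1 : ((n : ℝ) + 2) * ∫ ω, ‖x (n + 1) ω - z‖ ∂μ ≤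
          D + ((n : ℝ) + 1) * (∫ ω, ‖x n ω - z‖ ∂μ + ∫ ω, ‖u n ω‖ ∂μ) := by
        have i1 : Integrable (fun ω => ‖x n ω - z‖ + ‖u n ω‖) μ := (hia n).add (hiu n)
        have i2 : Integrable (fun ω => ((n : ℝ) + 1) * (‖x n ω - z‖ + ‖u n ω‖)) μ :=
          i1.const_mul _
        rw [← integral_const_mul]
        refine (integral_mono ((hia (n + 1)).const_mul _) (hcD.add i2) fun ω => ?_).trans_eq ?_
        · have := (hx ω).norm_sub_fixed_le hT hz n
          simp only [hx₀] at this
          simp only [Pi.add_apply]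
          linarith
        · simp only [Pi.add_apply]
          rw [integral_add hcD i2, hintD, integral_const_mul, integral_add (hia n) (hiu n)]
      have h2 : ((n : ℝ) + 1) * (K / ((n : ℝ) + 1) ^ 2) ≤ K := by
        rw [show ((n : ℝ) + 1) * (K / ((n : ℝ) + 1) ^ 2) = K / ((n : ℝ) + 1) by field_simp]
        exact div_le_self hK0 (by linarith [(Nat.cast_nonneg n : (0 : ℝ) ≤ n)])
      have h3 : ((n : ℝ) + 1) * (∫ ω, ‖x n ω - z‖ ∂μ + ∫ ω, ‖u n ω‖ ∂μ) ≤
          ((n : ℝ) + 1) * (D + K + K / ((n : ℝ) + 1) ^ 2) := by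
        gcongr
        exact hu n
      have hn : (0 : ℝ) < n + 2 := by positivity
      refine le_of_mul_le_mul_left ?_ hn
      linarith
  -- Each increment is at most `(5 K + 2 D + 2 K) / (n + 2)`: the two errors give `5 K`, the change
  -- of weights the rest. Hence the 7, and the logarithm as a telescoped harmonic sum.
  have hd : ∀ n : ℕ, ((n : ℝ) + 2) * ∫ ω, ‖x (n + 1) ω - x n ω‖ ∂μ ≤
      7 * (D + K) * (1 + Real.log ((n : ℝ) + 1)) := by
    intro n
    induction n with
    | zero =>
      have h1 : 2 * ∫ ω, ‖x 1 ω - x 0 ω‖ ∂μ ≤ 2 * D + ∫ ω, ‖u 0 ω‖ ∂μ := by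
        rw [← integral_const_mul, show 2 * D = ∫ _, 2 * D ∂μ by simp,
          ← integral_add (integrable_const _) (hiu 0)]
        refine integral_mono ((hid 0).const_mul _) ((integrable_const _).add (hiu 0)) fun ω => ?_
        have := (hx ω).norm_first_step_le hT hz
        simp only [hx₀] at this
        simp only [hx₀]
        linarith
      have h2 := hu 0
      simp only [Nat.cast_zero, zero_add, one_pow, div_one, Real.log_one, add_zero, mul_one] at h2 ⊢
      linarith
    | succ n ih =>
      have h1 : ((n : ℝ) + 3) * ∫ ω, ‖x (n + 2) ω - x (n + 1) ω‖ ∂μ ≤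
          ((n : ℝ) + 2) * (∫ ω, ‖x (n + 1) ω - x n ω‖ ∂μ +
            (∫ ω, ‖u (n + 1) ω‖ ∂μ + ∫ ω, ‖u n ω‖ ∂μ)) +
          1 / ((n : ℝ) + 2) * (∫ ω, ‖x n ω - z‖ ∂μ + ∫ ω, ‖u n ω‖ ∂μ + D) := by
        have i1 : Integrable (fun ω => ‖u (n + 1) ω‖ + ‖u n ω‖) μ := (hiu (n + 1)).add (hiu n)
        have i2 : Integrable (fun ω => ‖x (n + 1) ω - x n ω‖ + (‖u (n + 1) ω‖ + ‖u n ω‖)) μ :=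
          (hid n).add i1
        have i3 : Integrable (fun ω => ‖x n ω - z‖ + ‖u n ω‖) μ := (hia n).add (hiu n)
        have i4 : Integrable (fun ω => ‖x n ω - z‖ + ‖u n ω‖ + D) μ := i3.add hcD
        rw [← integral_const_mul]
        refine (integral_mono ((hid (n + 1)).const_mul _) ((i2.const_mul ((n : ℝ) + 2)).add
          (i4.const_mul (1 / ((n : ℝ) + 2)))) fun ω => ?_).trans_eq ?_
        · refine ((hx ω).norm_step_le hT hz n).trans ?_
          simp only [Pi.add_apply, hx₀]
          gcongr
        · simp only [Pi.add_apply]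
          rw [integral_add (i2.const_mul _) (i4.const_mul _), integral_const_mul,
            integral_const_mul, integral_add (hid n) i1, integral_add (hiu (n + 1)) (hiu n),
            integral_add i3 hcD, integral_add (hia n) (hiu n), hintD]
      have hq : (0 : ℝ) < n + 2 := by positivity
      have h2 : ((n : ℝ) + 2) * (K / ((n : ℝ) + 2) ^ 2 + K / ((n : ℝ) + 1) ^ 2) ≤
          5 * K * (1 / ((n : ℝ) + 2)) := by
        have e1 : ((n : ℝ) + 2) * (K / ((n : ℝ) + 2) ^ 2) = K * (1 / ((n : ℝ) + 2)) := by
          field_simp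
        have e2 : ((n : ℝ) + 2) * (K / ((n : ℝ) + 1) ^ 2) ≤ 4 * K * (1 / ((n : ℝ) + 2)) := by
          rw [mul_one_div, mul_div_assoc', div_le_div_iff₀ (by positivity) hq]
          nlinarith [mul_nonneg hK0 (Nat.cast_nonneg n : (0 : ℝ) ≤ n),
            mul_nonneg hK0 (sq_nonneg (n : ℝ))]
        rw [mul_add, e1]
        linarith
      have h3 : ∫ ω, ‖u n ω‖ ∂μ ≤ K := (hu n).trans
        (div_le_self hK0 (one_le_pow₀ (by linarith [(Nat.cast_nonneg n : (0 : ℝ) ≤ n)])))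
      have hu1 := hu (n + 1)
      push_cast at hu1
      rw [show (n : ℝ) + 1 + 1 = n + 2 by ring] at hu1
      have h4 : ((n : ℝ) + 2) * (∫ ω, ‖u (n + 1) ω‖ ∂μ + ∫ ω, ‖u n ω‖ ∂μ) ≤
          5 * K * (1 / ((n : ℝ) + 2)) :=
        (mul_le_mul_of_nonneg_left (add_le_add hu1 (hu n)) hq.le).trans h2
      have h5 : 1 / ((n : ℝ) + 2) * (∫ ω, ‖x n ω - z‖ ∂μ + ∫ ω, ‖u n ω‖ ∂μ + D) ≤
          1 / ((n : ℝ) + 2) * (2 * D + 2 * K) :=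
        mul_le_mul_of_nonneg_left (by linarith [ha n]) (by positivity)
      have h6 := mul_le_mul_of_nonneg_left (one_div_le_log_sub_log n)
        (show 0 ≤ 7 * (D + K) by positivity)
      have h7 : 0 ≤ D * (1 / ((n : ℝ) + 2)) := by positivity
      push_cast
      rw [show (n : ℝ) + 1 + 1 = n + 2 by ring, show (n : ℝ) + 1 + 2 = n + 3 by ring]
      linarith
  have h1 : ((n : ℝ) + 2) * ∫ ω, ‖T (x (n + 1) ω) - x (n + 1) ω‖ ∂μ ≤
      (∫ ω, ‖x (n + 1) ω - z‖ ∂μ + D) +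
        ((n : ℝ) + 1) * (∫ ω, ‖x (n + 1) ω - x n ω‖ ∂μ + ∫ ω, ‖u n ω‖ ∂μ) := by
    have i1 : Integrable (fun ω => ‖x (n + 1) ω - x n ω‖ + ‖u n ω‖) μ := (hid n).add (hiu n)
    have i2 : Integrable (fun ω => ‖x (n + 1) ω - z‖ + D) μ := (hia (n + 1)).add hcD
    rw [← integral_const_mul]
    refine (integral_mono ((hie (n + 1)).const_mul _) (i2.add (i1.const_mul ((n : ℝ) + 1)))
      fun ω => ?_).trans_eq ?_
    · refine ((hx ω).norm_residual_le hT hz n).trans ?_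
      simp only [Pi.add_apply, hx₀]
      gcongr
    · simp only [Pi.add_apply]
      rw [integral_add i2 (i1.const_mul _), integral_const_mul, integral_add (hia (n + 1)) hcD,
        integral_add (hid n) (hiu n), hintD]
  have hn : (0 : ℝ) ≤ n := Nat.cast_nonneg n
  have h2 : ((n : ℝ) + 1) * ∫ ω, ‖u n ω‖ ∂μ ≤ K := by
    refine (mul_le_mul_of_nonneg_left (hu n) (by positivity)).trans ?_
    rw [show ((n : ℝ) + 1) * (K / ((n : ℝ) + 1) ^ 2) = K / ((n : ℝ) + 1) by field_simp]
    exact div_le_self hK0 (by linarith)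
  have h3 : ((n : ℝ) + 1) * ∫ ω, ‖x (n + 1) ω - x n ω‖ ∂μ ≤
      7 * (D + K) * (1 + Real.log ((n : ℝ) + 1)) := by
    refine le_trans ?_ (hd n)
    gcongr
    norm_num
  have h4 : 0 ≤ Real.log ((n : ℝ) + 1) := Real.log_nonneg (by linarith)
  have h5 : 0 ≤ (D + K) * Real.log ((n : ℝ) + 1) := by positivity
  linarith [ha (n + 1)]

end Halpern

/-! ### Choice of the number of iterations -/

/-- The tangent to the logarithm at `4 * a` costs only `t / 2`, which the right side absorbs. This
resolves the circular choice of `t`, on which `log n` depends. -/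
lemma exists_forall_mul_log_le (a c : ℝ) (ha : 1 ≤ a) (hc : 1 ≤ c) :
    ∃ t : ℝ, 1 ≤ t ∧ a * (5 + 2 * Real.log (t + c)) ≤ t := by
  have hl : 0 ≤ Real.log (4 * a) := Real.log_nonneg (by linarith)
  have hal : 0 ≤ a * Real.log (4 * a) := mul_nonneg (by linarith) hl
  refine ⟨c + 10 * a + 4 * (a * Real.log (4 * a)), by linarith, ?_⟩
  set t := c + 10 * a + 4 * (a * Real.log (4 * a)) with ht
  have h1 := Real.log_le_sub_one_of_pos (show 0 < (t + c) / (4 * a) by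
    have : 0 < t + c := by linarith
    positivity)
  rw [Real.log_div (by linarith) (by linarith)] at h1
  have h2 : a * Real.log (t + c) ≤ a * Real.log (4 * a) + (t + c) / 4 - a := by
    have h3 := mul_le_mul_of_nonneg_left h1 (show 0 ≤ a by linarith)
    have h4 : a * ((t + c) / (4 * a)) = (t + c) / 4 := by
      have : a ≠ 0 := by linarith
      field_simp
    linarith
  linarith

/-- The number of iterations that brings the error bound below `ε`, and its sample complexity. -/
lemma exists_iteration_count {b : ℝ} (hb : 0 ≤ b) :
    ∃ C : ℝ, 0 < C ∧ ∀ m ε : ℝ, 1 ≤ m → 0 < ε → ε < 2 * (b + 1) → ∃ n : ℕ,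
      9 * (b + 1 + 2 * (b + 1) * √(Real.log (2 * m))) * (1 + Real.log ((n : ℝ) + 1)) ≤
        ε * ((n : ℝ) + 2) ∧
      ((n : ℝ) + 1) ^ 7 ≤ C * (1 / ε) ^ 7 * Real.log (2 + m / ε) ^ 14 := by
  set c : ℝ := 2 * (b + 1) with hc
  have hc2 : 2 ≤ c := by linarith
  set α : ℝ := 2 * Real.log (2 * c) + 1 with hα
  have hα1 : 1 ≤ α := by
    have : 0 ≤ Real.log (2 * c) := Real.log_nonneg (by linarith)
    linarith
  set a : ℝ := 9 * (b + 1) * (4 + α) with ha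
  have ha1 : 1 ≤ a := by nlinarith
  obtain ⟨t, ht1, ht⟩ := exists_forall_mul_log_le a c ha1 (by linarith)
  refine ⟨(t + 4 * c) ^ 7, by positivity, fun m ε hm hε hεc => ?_⟩
  set l := Real.log (2 + m / ε) with hl
  have hmε : 0 < m / ε := by positivity
  have hexp : Real.exp l = 2 + m / ε := Real.exp_log (by positivity)
  have hl2 : 1 / 2 ≤ l := by
    have h1 : Real.log 2 ≤ l := Real.log_le_log (by norm_num) (by linarith)
    linarith [Real.log_two_gt_d9]
  have hinv : 1 / ε ≤ Real.exp l := by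
    rw [hexp]
    have : 1 / ε ≤ m / ε := div_le_div_of_nonneg_right hm hε.le
    linarith
  have hlog2m : Real.log (2 * m) ≤ α * l := by
    have h1 : 2 * m ≤ 2 * c * (2 + m / ε) := by
      have h2 : m = ε * (m / ε) := by field_simp
      have h3 : ε * (m / ε) ≤ c * (m / ε) := mul_le_mul_of_nonneg_right hεc.le hmε.le
      linarith
    have h2 := Real.log_le_log (by linarith) h1
    rw [Real.log_mul (x := 2 * c) (by linarith) (by positivity), ← hl] at h2
    have h3 : 0 ≤ Real.log (2 * c) := Real.log_nonneg (by linarith)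
    nlinarith
  have hαl : 0 ≤ α * l := by positivity
  have hsqrt : 1 + 2 * √(Real.log (2 * m)) ≤ (4 + α) * l := by
    have h1 := Real.sqrt_le_sqrt hlog2m
    have h2 : 2 * √(α * l) ≤ α * l + 1 := by
      nlinarith [sq_nonneg (√(α * l) - 1), Real.sq_sqrt hαl]
    linarith
  have hfactor : 9 * (b + 1 + c * √(Real.log (2 * m))) ≤ a * l := by
    have h1 := mul_le_mul_of_nonneg_left hsqrt (show 0 ≤ 9 * (b + 1) by positivity)
    rw [ha, hc]
    linarith
  -- One factor `l` pays for the noise term `√(log (2 * m))`, the other for `log (n + 1)`.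
  set y : ℝ := t * l ^ 2 / ε with hy
  have hy0 : 0 ≤ y := by positivity
  refine ⟨⌊y⌋₊, ?_, ?_⟩
  · have hn1 : ((⌊y⌋₊ : ℕ) : ℝ) ≤ y := Nat.floor_le hy0
    have hn2 : y < (⌊y⌋₊ : ℕ) + 1 := Nat.lt_floor_add_one y
    set n : ℝ := ((⌊y⌋₊ : ℕ) : ℝ)
    have hn0 : 0 ≤ n := Nat.cast_nonneg _
    have hle : n + 1 ≤ (t + c) * Real.exp (3 * l) := by
      have hE : Real.exp (3 * l) = Real.exp l * Real.exp l * Real.exp l := by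
        rw [← Real.exp_add, ← Real.exp_add]; congr 1; ring
      have hel : l ≤ Real.exp l := by linarith [Real.add_one_le_exp l]
      have he1 : 1 ≤ Real.exp l := Real.one_le_exp (by linarith)
      have hll : l ^ 2 ≤ Real.exp l * Real.exp l := by
        rw [sq]; exact mul_le_mul hel hel (by linarith) (by linarith)
      have h1 : y ≤ t * Real.exp (3 * l) := by
        rw [hy, hE, div_eq_mul_one_div, mul_assoc]
        exact mul_le_mul_of_nonneg_left (mul_le_mul hll hinv (by positivity) (by positivity))
          (by linarith)
      have h2 : 1 ≤ c * Real.exp (3 * l) := by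
        have : 1 ≤ Real.exp (3 * l) := Real.one_le_exp (by linarith)
        nlinarith
      linarith
    have hlogn : Real.log (n + 1) ≤ Real.log (t + c) + 3 * l := by
      have h1 := Real.log_le_log (by linarith) hle
      rwa [Real.log_mul (by linarith) (Real.exp_pos _).ne', Real.log_exp] at h1
    have hltc : 0 ≤ Real.log (t + c) := Real.log_nonneg (by linarith)
    have hbound : 1 + Real.log (n + 1) ≤ (5 + 2 * Real.log (t + c)) * l := by nlinarith
    have hlogn0 : 0 ≤ Real.log (n + 1) := Real.log_nonneg (by linarith)
    calc 9 * (b + 1 + c * √(Real.log (2 * m))) * (1 + Real.log (n + 1)) ≤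
          a * l * ((5 + 2 * Real.log (t + c)) * l) :=
          mul_le_mul hfactor hbound (by linarith) (by positivity)
      _ = a * (5 + 2 * Real.log (t + c)) * l ^ 2 := by ring
      _ ≤ t * l ^ 2 := mul_le_mul_of_nonneg_right ht (by positivity)
      _ = ε * y := by rw [hy]; field_simp
      _ ≤ ε * (n + 2) := mul_le_mul_of_nonneg_left (by linarith) hε.le
  · have hn1 : ((⌊y⌋₊ : ℕ) : ℝ) ≤ y := Nat.floor_le hy0
    -- Absorbs the rounding `+ 1`; this needs `ε < c` and `l ≥ 1 / 2`.
    have h1 : 1 ≤ 4 * c * l ^ 2 / ε := by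
      rw [le_div_iff₀ hε]
      have h4 : 1 ≤ 4 * l ^ 2 := by nlinarith
      nlinarith
    have h2 : ((⌊y⌋₊ : ℕ) : ℝ) + 1 ≤ (t + 4 * c) * (1 / ε) * l ^ 2 := by
      calc _ ≤ y + 4 * c * l ^ 2 / ε := by linarith
        _ = _ := by rw [hy]; ring
    calc _ ≤ ((t + 4 * c) * (1 / ε) * l ^ 2) ^ 7 := by gcongr
      _ = _ := by ring

/-! ### Assembly -/

namespace MDP

variable {S A : Type*} [Fintype S] [Nonempty S] [Fintype A] [Nonempty A] {M : MDP S A}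
  [MeasurableSpace S] [MeasurableSingletonClass S] {Ω : Type*} [MeasurableSpace Ω]
  {μ : Measure Ω} [IsProbabilityMeasure μ] {X : ℕ → ℕ → S × A → Ω → S}

lemma IsSampling.integrable_residual (hX : M.IsSampling μ X) (v : ℝ) (Q₀ : S × A → ℝ) (n : ℕ) :
    Integrable (fun ω => ‖M.bellman v (M.centeredTable v Q₀ n fun j i y => X j i y ω) -
      M.centeredTable v Q₀ n fun j i y => X j i y ω‖) μ :=
  hX.integrable (n := n) (φ := fun x => ‖M.bellman v (M.centeredTable v Q₀ n x) -
    M.centeredTable v Q₀ n x‖) fun x x' h => by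
      simp only [M.dependsOnSamples_centeredTable v Q₀ n x x' h]

lemma IsSampling.integral_residual_le (hX : M.IsSampling μ X) {v : ℝ}
    (hv : v ∈ Set.Icc (0 : ℝ) 1) (Q₀ : S × A → ℝ) {z : S × A → ℝ} (hz : M.bellman v z = z) {D : ℝ}
    (hD : ‖Q₀ - z‖ ≤ D) (n : ℕ) :
    ((n : ℝ) + 2) * ∫ ω, ‖M.bellman v (M.centeredTable v Q₀ (n + 1) fun j i y => X j i y ω) -
      M.centeredTable v Q₀ (n + 1) fun j i y => X j i y ω‖ ∂μ ≤
      9 * (D + 2 * (‖Q₀‖ + 1) * √(Real.log (2 * Fintype.card (S × A)))) *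
        (1 + Real.log ((n : ℝ) + 1)) := by
  have hdep := M.dependsOnSamples_centeredTable v Q₀
  refine AvgMDP.integral_residual_le (T := M.bellman v)
    (x := fun n ω => M.centeredTable v Q₀ n fun j i y => X j i y ω)
    (u := fun n ω => M.noise v Q₀ n fun j i y => X j i y ω) (M.norm_bellman_sub_le v) hz
    (fun ω n => M.centeredTable_succ v Q₀ n _) (fun ω => rfl) hD (fun n => ?_) (fun n => ?_)
    (fun n => ?_) (hX.integrable_residual v Q₀) (hX.integral_norm_noise_le Q₀ hv) n
  · exact hX.integrable (n := n) (φ := fun x => ‖M.centeredTable v Q₀ n x - z‖) fun x x' h => by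
      simp only [hdep n x x' h]
  · exact hX.integrable (n := n + 1)
      (φ := fun x => ‖M.centeredTable v Q₀ (n + 1) x - M.centeredTable v Q₀ n x‖)
      fun x x' h => by
        simp only [hdep (n + 1) x x' h, (hdep n).mono n.le_succ x x' h]
  · exact hX.integrable (n := n + 1) (φ := fun x => ‖M.noise v Q₀ n x‖) fun x x' h => by
      simp only [M.dependsOnSamples_noise v Q₀ n x x' h]

end MDP

/-- The residual of the optimality equation does not depend on the offset function. -/
lemma MDP.residual_randomRun {S A : Type*} [Fintype S] [Fintype A] [Nonempty A] (M : MDP S A)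
    (v : ℝ) (f : (S × A → ℝ) → ℝ) (Q₀ : S × A → ℝ) {Ω : Type*} (X : ℕ → ℕ → S × A → Ω → S) (n : ℕ)
    (ω : Ω) : M.bellman v (M.randomRun f Q₀ X n ω).Q - (M.randomRun f Q₀ X n ω).Q =
      M.bellman v (M.centeredTable v Q₀ n fun j i y => X j i y ω) -
        M.centeredTable v Q₀ n fun j i y => X j i y ω := by
  obtain ⟨c, hc⟩ := M.exists_run_Q_eq_add_const (β := halpernWeight) v (f := f) Q₀
    (fun j i y => X j i y ω) (fun n hn => by
      rw [batchSize, pow_eq_zero_iff (by norm_num)] at hn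
      simp [hn, halpernWeight]) n
  rw [randomRun, hc, bellman_add_const]
  simp only [centeredTable]
  abel

end AvgMDP

end

theorem theorem4 :
    ∃ p : ℕ, ∀ B : ℝ, ∃ C : ℝ, 0 < C ∧
      ∀ (S A : Type*) [Fintype S] [DecidableEq S] [Nonempty S] [Fintype A] [Nonempty A]
        [MeasurableSpace S] [MeasurableSingletonClass S]
        (M : AvgMDP.MDP S A) (s₀ : S) (Q₀ : S × A → ℝ),
        M.Unichain →
        ‖Q₀‖ ≤ B →
        Metric.infDist Q₀ {Q | M.bellman (M.optValue s₀) Q = Q} ≤ B →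
        ∀ ε : ℝ, 0 < ε →
          ∃ N : ℕ,
            ∀ (f : (S × A → ℝ) → ℝ), (∀ (Q : S × A → ℝ) (c : ℝ), f (Q + fun _ => c) = f Q + c) →
            ∀ (Ω : Type*) [MeasurableSpace Ω] (μ : MeasureTheory.Measure Ω)
              [MeasureTheory.IsProbabilityMeasure μ] (X : ℕ → ℕ → S × A → Ω → S),
              M.IsSampling μ X →
              MeasureTheory.Integrable
                  (fun ω => ‖M.bellman (M.optValue s₀) (M.randomRun f Q₀ X N ω).Q -
                    (M.randomRun f Q₀ X N ω).Q‖) μ ∧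
                ∫ ω, ‖M.bellman (M.optValue s₀) (M.randomRun f Q₀ X N ω).Q -
                    (M.randomRun f Q₀ X N ω).Q‖ ∂μ ≤ ε ∧
                ∀ ω, ((M.randomRun f Q₀ X N ω).calls : ℝ) ≤
                  C * (Fintype.card (S × A) : ℝ) * (1 / ε) ^ 7 *
                    Real.log (2 + (Fintype.card (S × A) : ℝ) / ε) ^ p := by
  refine ⟨14, fun B => ?_⟩
  obtain ⟨C, hC, hcount⟩ := AvgMDP.exists_iteration_count (abs_nonneg B)
  refine ⟨C, hC, ?_⟩
  intro S A _ _ _ _ _ _ _ M s₀ Q₀ hM hQ₀ hdist ε hε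
  set v := M.optValue s₀
  have hv : v ∈ Set.Icc (0 : ℝ) 1 := M.optValue_mem_Icc hM s₀
  -- Nonemptiness matters, as `infDist` to the empty set is 0. The `+ 1` is slack for an infimum,
  -- which spares proving that it is attained.
  obtain ⟨z, hz, hzB⟩ : ∃ z, M.bellman v z = z ∧ ‖Q₀ - z‖ ≤ |B| + 1 := by
    obtain ⟨z, hz, hlt⟩ := (Metric.infDist_lt_iff
      (show {Q | M.bellman v Q = Q}.Nonempty from M.exists_bellman_optValue_eq hM s₀)).1
      (show Metric.infDist Q₀ {Q | M.bellman v Q = Q} < |B| + 1 by linarith [le_abs_self B])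
    exact ⟨z, hz, by rw [← dist_eq_norm]; exact hlt.le⟩
  have hm : (1 : ℝ) ≤ Fintype.card (S × A) := by exact_mod_cast Fintype.card_pos
  -- For large `ε` the allowed number of calls can drop below one iteration's cost, so none is made:
  -- the initial residual is at most `2 * ‖Q₀ - z‖`.
  rcases le_or_gt (2 * (|B| + 1)) ε with hlarge | hsmall
  · refine ⟨0, fun f _ Ω _ μ _ X hX => ?_⟩
    simp only [M.residual_randomRun]
    refine ⟨hX.integrable_residual v Q₀ 0, ?_, fun ω => ?_⟩
    · simp only [M.centeredTable_zero, MeasureTheory.integral_const, MeasureTheory.probReal_univ,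
        one_smul]
      have h1 := M.norm_bellman_sub_le v Q₀ z
      rw [hz] at h1
      have h2 : M.bellman v Q₀ - Q₀ = (M.bellman v Q₀ - z) - (Q₀ - z) := by abel
      rw [h2]
      linarith [norm_sub_le (M.bellman v Q₀ - z) (Q₀ - z)]
    · have h1 : 0 ≤ Real.log (2 + (Fintype.card (S × A) : ℝ) / ε) :=
        Real.log_nonneg (by
          have : 0 ≤ (Fintype.card (S × A) : ℝ) / ε := by positivity
          linarith)
      have h2 : (M.randomRun f Q₀ X 0 ω).calls = 0 := rfl
      rw [h2, Nat.cast_zero]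
      positivity
  · obtain ⟨n, hn, hcalls⟩ := hcount _ ε hm hε hsmall
    refine ⟨n + 1, fun f _ Ω _ μ _ X hX => ?_⟩
    simp only [M.residual_randomRun]
    refine ⟨hX.integrable_residual v Q₀ (n + 1), ?_, fun ω => ?_⟩
    · have h1 := hX.integral_residual_le hv Q₀ hz hzB n
      have hlog : 0 ≤ Real.log ((n : ℝ) + 1) :=
        Real.log_nonneg (by linarith [(Nat.cast_nonneg n : (0 : ℝ) ≤ n)])
      have h2 : 9 * (|B| + 1 + 2 * (‖Q₀‖ + 1) * √(Real.log (2 * Fintype.card (S × A)))) *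
          (1 + Real.log ((n : ℝ) + 1)) ≤ 9 * (|B| + 1 + 2 * (|B| + 1) *
            √(Real.log (2 * Fintype.card (S × A)))) * (1 + Real.log ((n : ℝ) + 1)) := by
        gcongr
        exact hQ₀.trans (le_abs_self B)
      refine le_of_mul_le_mul_left ?_ (show (0 : ℝ) < n + 2 by positivity)
      linarith
    · have h1 : ((M.randomRun f Q₀ X (n + 1) ω).calls : ℝ) ≤
          (Fintype.card (S × A) : ℝ) * ((n : ℝ) + 1) ^ 7 := by
        exact_mod_cast M.calls_run AvgMDP.halpernWeight f Q₀ (fun j i y => X j i y ω) (n + 1)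
      refine h1.trans ((mul_le_mul_of_nonneg_left hcalls (by positivity)).trans_eq ?_)
      ring
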